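/- \textbf{Setting.} Let $n=n^u+n^s$, $m\ge 2$, $A=\mathrm{diag}(A^u,A^s)\in\mathbb R^{n\times n}$ with all eigenvalues of $A^u$ on or outside the unit circle and all eigenvalues of $A^s$ strictly inside it. Consider $x(k+1)=Ax(k)+w(k)$, $y(k)=Cx(k)+v(k)$, where $C\in\mathbb R^{m\times n}$ has rows $C_i=[C_i^u\;C_i^s]$, and $x(0)\sim\mathcal N(0,\Sigma)$, $w(k)\sim\mathcal N(0,Q)$, $v(k)\sim\mathcal N(0,R)$ are mutually independent ($\Sigma,Q,R\ge0$). Let $P(0)=\Sigma$, $P^-(k)=AP(k)A^T+Q$, $P(k+1)=P^-(k)-P^-(k)C^T(CP^-(k)C^T+R)^{-1}CP^-(k)$ be the Kalman error covariances. Assume that $P=\lim_k P(k)$ exists and that the filter is in steady state, $\Sigma=P$. With $P^-=APA^T+Q$ and $CP^-C^T+R$ invertible, let $K=P^-C^T(CP^-C^T+R)^{-1}$ and let $\hat x(0)=0$, $\hat x(k+1)=A\hat x(k)+K(y(k+1)-CA\hat x(k))$ be the Kalman estimate. Let $\mathbf 1$ be the all-ones vector. Let $\Lambda\in\mathbb R^{n\times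 n}$ have all eigenvalues strictly inside the unit circle and the characteristic polynomial of $A-KCA$; let $F_1,\dots,F_m\in\mathbb R^{n\times n}$ satisfy $F_i\Lambda=(A-KCA)F_i$ and $F_i\mathbf 1_n=K_i$ (the $i$-th column of $K$); let $\beta\in\mathbb R^n$ be such that $S=\Lambda+\mathbf 1_n\beta^T$ has no eigenvalue in common with $\Lambda$ and its characteristic polynomial is that of $A^u$ times a polynomial all of whose roots lie strictly inside the unit circle. Let $F=[F_1,\dots,F_m]$, $\tilde S=I_m\otimes S$, $\tilde B=I_m\otimes\mathbf 1_n$, $\tilde L_i=e_i\otimes\mathbf 1_n$. The sensors communicate over a connected undirected graph with symmetric weights $a_{ij}\ge0$, Laplacian $\mathcal L$ and Laplacian eigenvalues $0=\mu_1<\mu_2\le\dots\le\mu_m$. Let $\Phi=[\tfrac1{\sqrt m}\mathbf 1_m,\phi_2,\dots,\phi_m]$ be orthogonal with $\Phi^T\mathcal L\Phi=\mathrm{diag}(\mu_1,\dots,\mu_m)$, and put $\Phi_2=[\phi_2,\dots,\phi_m]$. Assume that the product of the moduli of the eigenvalues $\lambda_j^u(S)$ of $S$ on or outside the unit circle satisfies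 $$\prod_j|\lambda_j^u(S)|<\frac{1+\mu_2/\mu_m}{1-\mu_2/\mu_m}$$ (the right-hand side being $+\infty$ if $\mu_2=\mu_m$). Let $\zeta>0$ satisfy $\prod_j|\lambda^u_j(S)|<\zeta^{-1}\le\frac{1+\mu_2/\mu_m}{1-\mu_2/\mu_m}$, let $\mathcal P>0$ satisfy $$\mathcal P-S^T\mathcal PS+(1-\zeta^2)\frac{S^T\mathcal P\mathbf 1_n\mathbf 1_n^T\mathcal PS}{\mathbf 1_n^T\mathcal P\mathbf 1_n}>0,$$ and set $\Gamma=\frac{2}{\mu_2+\mu_m}\frac{\mathbf 1_n^T\mathcal PS}{\mathbf 1_n^T\mathcal P\mathbf 1_n}$, $\tilde\Gamma=I_m\otimes\Gamma$. Each sensor $i$ starts with $\hat\xi_i(0)=0$, $\eta_i(0)=0$ and runs $$z_i(k)=y_i(k+1)-\beta^T\hat\xi_i(k),\qquad \hat\xi_i(k+1)=S\hat\xi_i(k)+\mathbf 1_nz_i(k),$$ $$\eta_i(k+1)=\tilde S\eta_i(k)+\tilde L_iz_i(k)+\tilde B\sum_j a_{ij}\,\tilde\Gamma(\eta_j(k)-\eta_i(k)),\qquad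 \breve x_i(k)=mF\eta_i(k).$$ Put $\bar e(k)=\mathrm{col}_i(\breve x_i(k)-\hat x(k))$ and $\breve e(k)=\mathrm{col}_i(\breve x_i(k)-x(k))$. \textbf{Claim.} The limits $\bar W=\lim_k\mathrm{cov}(\bar e(k))$ and $\breve W=\lim_k\mathrm{cov}(\breve e(k))$ exist, $\mathrm{cov}(\hat x(k)-x(k))=P$ for all $k$, and $$\breve W=\bar W+(\mathbf 1_m\mathbf 1_m^T)\otimes P .$$ Moreover $\breve W$ is computed exactly as follows. For each $i$ the linear equations $SG_i^u=G_i^uA^u$, $\beta^TG_i^u=C_i^uA^u$ have a unique solution $G_i^u\in\mathbb R^{n\times n^u}$; let $G_i=[G_i^u\;0]$. Let $L_\eta=\mathrm{diag}(\tilde L_1,\dots,\tilde L_m)$, $L=[\Phi_2^T(I_m-\tfrac1m\mathbf 1_m\mathbf 1_m^T)\otimes I_{mn}]L_\eta$, $C^s=\mathrm{col}_i(C_i^s)$, $J=[0\;I_{n^s}]$, $$A_r=\begin{bmatrix}\mathrm{diag}_{j=2}^m(\tilde S-\mu_j\tilde B\tilde\Gamma)&L(I_m\otimes\beta^T)&LC^sA^s\\0&I_m\otimes\Lambda&-\tilde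 BC^sA^s\\0&0&A^s\end{bmatrix},\quad B_w=\begin{bmatrix}LC\\ \mathrm{col}_i(G_i-\mathbf 1_nC_i)\\J\end{bmatrix},\quad B_v=\begin{bmatrix}L\\-\tilde B\\0\end{bmatrix}.$$ Then the Lyapunov equation $W_r=A_rW_rA_r^T+B_wQB_w^T+B_vRB_v^T$ has a unique solution $W_r$, and $\bar W=E W_rE^T$ with $E=(I_m\otimes mF)\,[\Phi_2\otimes I_{mn}\;\;0\;\;0]$. -/

import Mathlib

open Matrix Filter Topology MeasureTheory ProbabilityTheory
open scoped Kronecker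

noncomputable section

namespace DistKalman

/-! ### Linear algebra -/

/-- All complex eigenvalues of the real square matrix `M` lie strictly inside the unit circle. -/
def IsSchur {ι : Type*} [Fintype ι] [DecidableEq ι] (M : Matrix ι ι ℝ) : Prop :=
  ∀ z ∈ spectrum ℂ (M.map (algebraMap ℝ ℂ)), ‖z‖ < 1

open Classical in
/-- The product of the moduli of the unstable eigenvalues (those with `1 ≤ |λ|`), counted with
algebraic multiplicity; it is `1` if there are none. -/
def unstableProd {ι : Type*} [Fintype ι] [DecidableEq ι] (M : Matrix ι ι ℝ) : ℝ :=
  (((M.map (algebraMap ℝ ℂ)).charpoly.roots.filter (fun z => 1 ≤ ‖z‖)).map (fun z => ‖z‖)).prod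

/-- Covariance matrix of a random vector. -/
def covMat {Ω ι : Type*} [MeasurableSpace Ω] (Pr : Measure Ω) (X : Ω → ι → ℝ) : Matrix ι ι ℝ :=
  Matrix.of fun a b => cov[fun ω => X ω a, fun ω => X ω b; Pr]

/-! ### The plant and the centralized Kalman filter -/

/-- Index set of the `n = nu + ns` coordinates of the state: first the unstable part, then the
stable part. -/
abbrev Ix (nu ns : ℕ) : Type := Fin nu ⊕ Fin ns

/-- Data of the plant `x(k+1) = A x(k) + w(k)`, `y(k) = C x(k) + v(k)`, with `A = diag(Aᵘ, Aˢ)`;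
`Q`, `R`, `Sig` are the covariances of `w(k)`, `v(k)`, `x(0)`. -/
structure Plant (nu ns m : ℕ) where
  Au : Matrix (Fin nu) (Fin nu) ℝ
  As : Matrix (Fin ns) (Fin ns) ℝ
  C : Matrix (Fin m) (Ix nu ns) ℝ
  Q : Matrix (Ix nu ns) (Ix nu ns) ℝ
  R : Matrix (Fin m) (Fin m) ℝ
  Sig : Matrix (Ix nu ns) (Ix nu ns) ℝ

namespace Plant

variable {nu ns m : ℕ} (p : Plant nu ns m)

/-- The eigenvalues of `Aᵘ` are on or outside the unit circle, those of `Aˢ` strictly inside, and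
the noise covariances are positive semidefinite. -/
structure Valid : Prop where
  unstable : ∀ z ∈ spectrum ℂ (p.Au.map (algebraMap ℝ ℂ)), 1 ≤ ‖z‖
  stable : IsSchur p.As
  Q_psd : p.Q.PosSemidef
  R_psd : p.R.PosSemidef
  Sig_psd : p.Sig.PosSemidef

/-- The system matrix `A = diag(Aᵘ, Aˢ)`. -/
def A : Matrix (Ix nu ns) (Ix nu ns) ℝ := fromBlocks p.Au 0 0 p.As

/-- One-step prediction covariance `A P Aᵀ + Q`. -/
def predCov (P : Matrix (Ix nu ns) (Ix nu ns) ℝ) : Matrix (Ix nu ns) (Ix nu ns) ℝ :=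
  p.A * P * p.Aᵀ + p.Q

/-- Innovation covariance `C (A P Aᵀ + Q) Cᵀ + R`. -/
def innovCov (P : Matrix (Ix nu ns) (Ix nu ns) ℝ) : Matrix (Fin m) (Fin m) ℝ :=
  p.C * p.predCov P * p.Cᵀ + p.R

/-- Kalman gain when the covariance of the previous (filtered) estimate is `P`. -/
def gain (P : Matrix (Ix nu ns) (Ix nu ns) ℝ) : Matrix (Ix nu ns) (Fin m) ℝ :=
  p.predCov P * p.Cᵀ * (p.innovCov P)⁻¹

/-- The error covariance `P(k)` of the (filtered) estimate given by the Kalman filter, started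
from `P(0) = Sig`. -/
def kalmanCov : ℕ → Matrix (Ix nu ns) (Ix nu ns) ℝ
  | 0 => p.Sig
  | k + 1 => p.predCov (kalmanCov k) - p.gain (kalmanCov k) * p.C * p.predCov (kalmanCov k)

/-- State trajectory for given initial state and process noise. -/
def state (x0 : Ix nu ns → ℝ) (w : ℕ → Ix nu ns → ℝ) : ℕ → Ix nu ns → ℝ
  | 0 => x0
  | k + 1 => p.A *ᵥ state x0 w k + w k

/-- Measurements of all sensors. -/
def meas (x0 : Ix nu ns → ℝ) (w : ℕ → Ix nu ns → ℝ) (v : ℕ → Fin m → ℝ) (k : ℕ) : Fin m → ℝ :=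
  p.C *ᵥ p.state x0 w k + v k

/-- The Kalman estimate with fixed gain `K`, driven by the measurements `y`. -/
def estimate (K : Matrix (Ix nu ns) (Fin m) ℝ) (y : ℕ → Fin m → ℝ) : ℕ → Ix nu ns → ℝ
  | 0 => 0
  | k + 1 => p.A *ᵥ estimate K y k + K *ᵥ (y (k + 1) - p.C *ᵥ (p.A *ᵥ estimate K y k))

/-- `x(0) ∼ N(0, Sig)`, `w(k) ∼ N(0, Q)` and `v(k) ∼ N(0, R)` are mutually independent. -/
structure IsNoise {Ω : Type*} [MeasurableSpace Ω] (Pr : Measure Ω)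
    (x0 : Ω → Ix nu ns → ℝ) (w : ℕ → Ω → Ix nu ns → ℝ) (v : ℕ → Ω → Fin m → ℝ) : Prop where
  law_x0 : HasLaw (fun ω => WithLp.toLp 2 (x0 ω)) (multivariateGaussian 0 p.Sig) Pr
  law_w : ∀ k, HasLaw (fun ω => WithLp.toLp 2 (w k ω)) (multivariateGaussian 0 p.Q) Pr
  law_v : ∀ k, HasLaw (fun ω => WithLp.toLp 2 (v k ω)) (multivariateGaussian 0 p.R) Pr
  indep_w : iIndepFun w Pr
  indep_v : iIndepFun v Pr
  indep_x0_w : IndepFun x0 (fun ω k => w k ω) Pr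
  indep_v_all : IndepFun (fun ω k => v k ω) (fun ω => (x0 ω, fun k => w k ω)) Pr

end Plant

/-! ### The local filters -/

/-- Parameters of the local filters and of the fusion: `Λ`, `β` and `F₁, …, F_m`. -/
structure LocalFilter (nu ns m : ℕ) where
  Lam : Matrix (Ix nu ns) (Ix nu ns) ℝ
  β : Ix nu ns → ℝ
  F : Fin m → Matrix (Ix nu ns) (Ix nu ns) ℝ

namespace LocalFilter

variable {nu ns m : ℕ} (f : LocalFilter nu ns m)

/-- `S = Λ + 1 βᵀ`. -/
def S : Matrix (Ix nu ns) (Ix nu ns) ℝ := f.Lam + vecMulVec 1 f.β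

/-- The requirements on `Λ`, `F_i` and `β`, for the plant `p` and the Kalman gain `K`. -/
structure IsDecomposition (p : Plant nu ns m) (K : Matrix (Ix nu ns) (Fin m) ℝ) : Prop where
  lam_schur : IsSchur f.Lam
  lam_charpoly : f.Lam.charpoly = (p.A - K * p.C * p.A).charpoly
  F_comm : ∀ i, f.F i * f.Lam = (p.A - K * p.C * p.A) * f.F i
  F_one : ∀ i, f.F i *ᵥ 1 = fun a => K a i
  S_charpoly : ∃ q : Polynomial ℝ, f.S.charpoly = p.Au.charpoly * q ∧
    ∀ z : ℂ, Polynomial.aeval z q = 0 → ‖z‖ < 1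
  S_disjoint : Disjoint (spectrum ℂ (f.S.map (algebraMap ℝ ℂ)))
    (spectrum ℂ (f.Lam.map (algebraMap ℝ ℂ)))

/-- `F = [F₁, …, F_m]`. -/
def bigF : Matrix (Ix nu ns) (Fin m × Ix nu ns) ℝ := Matrix.of fun s ja => f.F ja.1 s ja.2

/-- The local filter state `ξ_i(k)` of sensor `i`, driven by the measurements `y`. -/
def xi (y : ℕ → Fin m → ℝ) : ℕ → Fin m → Ix nu ns → ℝ
  | 0 => 0
  | k + 1 => fun i => f.S *ᵥ xi y k i + (y (k + 1) i - f.β ⬝ᵥ xi y k i) • (1 : Ix nu ns → ℝ)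

/-- The residual `z_i(k) = y_i(k+1) - βᵀ ξ_i(k)`. -/
def resid (y : ℕ → Fin m → ℝ) (k : ℕ) (i : Fin m) : ℝ := y (k + 1) i - f.β ⬝ᵥ f.xi y k i

end LocalFilter

/-! ### The network and the consensus algorithm -/

/-- A connected weighted undirected graph on the sensors, given by its weighted adjacency matrix. -/
structure IsNetwork {m : ℕ} (a : Matrix (Fin m) (Fin m) ℝ) : Prop where
  nonneg : ∀ i j, 0 ≤ a i j
  symm : ∀ i j, a i j = a j i
  connected : (SimpleGraph.fromRel (fun i j => 0 < a i j)).Connected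

/-- The graph Laplacian `D - a`. -/
def laplacian {m : ℕ} (a : Matrix (Fin m) (Fin m) ℝ) : Matrix (Fin m) (Fin m) ℝ :=
  Matrix.diagonal (fun i => ∑ j, a i j) - a

/-- `Φ` is orthogonal with first column `1/√m` and `Φᵀ L Φ = diag(μ)` with `μ` nondecreasing; so
`μ` lists the eigenvalues of the Laplacian of `a` with multiplicity. -/
structure IsLapDiag {m : ℕ} (a : Matrix (Fin m) (Fin m) ℝ) (μ : Fin m → ℝ)
    (Φ : Matrix (Fin m) (Fin m) ℝ) : Prop where
  mono : Monotone μ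
  orth : Φᵀ * Φ = 1
  diag : Φᵀ * laplacian a * Φ = Matrix.diagonal μ
  first : ∀ i j : Fin m, (j : ℕ) = 0 → Φ i j = 1 / √(m : ℝ)

variable {nu ns m : ℕ}

/-- `S̃ = I_m ⊗ S`. -/
def Stil (m : ℕ) (S : Matrix (Ix nu ns) (Ix nu ns) ℝ) :
    Matrix (Fin m × Ix nu ns) (Fin m × Ix nu ns) ℝ := (1 : Matrix (Fin m) (Fin m) ℝ) ⊗ₖ S

/-- `B̃ = I_m ⊗ 1_n`; its `i`-th column is `L̃_i = e_i ⊗ 1_n`. -/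
def Btil (nu ns m : ℕ) : Matrix (Fin m × Ix nu ns) (Fin m) ℝ :=
  Matrix.of fun ja l => if ja.1 = l then 1 else 0

/-- `Γ̃ = I_m ⊗ Γ`. -/
def Gtil (m : ℕ) (Γ : Ix nu ns → ℝ) : Matrix (Fin m) (Fin m × Ix nu ns) ℝ :=
  Matrix.of fun l ja => if l = ja.1 then Γ ja.2 else 0

/-- The scalar `1ᵀ M 1`. -/
def onesForm (M : Matrix (Ix nu ns) (Ix nu ns) ℝ) : ℝ := 1 ⬝ᵥ M *ᵥ 1

/-- The row vector `Γ = 2/(μ₂ + μ_m) · 1ᵀ M S / (1ᵀ M 1)`. -/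
def consensusGain (μ₂ μm : ℝ) (M S : Matrix (Ix nu ns) (Ix nu ns) ℝ) : Ix nu ns → ℝ :=
  (2 / (μ₂ + μm) * (onesForm M)⁻¹) • ((1 : Ix nu ns → ℝ) ᵥ* (M * S))

/-- The modified algebraic Riccati inequality
`M - Sᵀ M S + (1 - ζ²) Sᵀ M 1 1ᵀ M S / (1ᵀ M 1) > 0`. -/
def RiccatiIneq (ζ : ℝ) (M S : Matrix (Ix nu ns) (Ix nu ns) ℝ) : Prop :=
  (M - Sᵀ * M * S + ((1 - ζ ^ 2) * (onesForm M)⁻¹) •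
    (Sᵀ * M * vecMulVec 1 1 * M * S)).PosDef

/-- The consensus states `η_i(k)`: `η_i(0) = 0` and, with `Δ_j(k) = Γ̃ η_j(k)`,
`η_i(k+1) = S̃ η_i(k) + L̃_i z_i(k) + B̃ ∑_j a_ij (Δ_j(k) - Δ_i(k))`. -/
def eta (a : Matrix (Fin m) (Fin m) ℝ) (f : LocalFilter nu ns m) (Γ : Ix nu ns → ℝ)
    (y : ℕ → Fin m → ℝ) : ℕ → Fin m → Fin m × Ix nu ns → ℝ
  | 0 => 0
  | k + 1 => fun i =>
      Stil m f.S *ᵥ eta a f Γ y k i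
        + f.resid y k i • (fun ja => Btil nu ns m ja i)
        + Btil nu ns m *ᵥ ∑ j, a i j • (Gtil m Γ *ᵥ eta a f Γ y k j - Gtil m Γ *ᵥ eta a f Γ y k i)

/-- The fused local estimate `m F η_i(k)` of sensor `i`. -/
def fused (a : Matrix (Fin m) (Fin m) ℝ) (f : LocalFilter nu ns m) (Γ : Ix nu ns → ℝ)
    (y : ℕ → Fin m → ℝ) (k : ℕ) (i : Fin m) : Ix nu ns → ℝ :=
  (m : ℝ) • (f.bigF *ᵥ eta a f Γ y k i)

/-! ### The Lyapunov equation -/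

/-- Indices `2, …, m` of the nonzero Laplacian eigenvalues. -/
abbrev Tail (m : ℕ) : Type := {j : Fin m // (j : ℕ) ≠ 0}

/-- Index set of the state `(δ̃₂, ε, xˢ)` of the reduced error dynamics, where `δ̃₂` collects the
consensus errors along the nontrivial Laplacian modes and `ε_i = G_i x - ξ_i`. -/
abbrev RIx (nu ns m : ℕ) : Type :=
  (Tail m × (Fin m × Ix nu ns)) ⊕ ((Fin m × Ix nu ns) ⊕ Fin ns)

/-- The last `m - 1` columns of `Φ`. -/
def tailCols (Φ : Matrix (Fin m) (Fin m) ℝ) : Matrix (Fin m) (Tail m) ℝ :=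
  Φ.submatrix id Subtype.val

/-- `L_η = diag(L̃_1, …, L̃_m)`. -/
def Leta (nu ns m : ℕ) : Matrix (Fin m × (Fin m × Ix nu ns)) (Fin m) ℝ :=
  Matrix.of fun ija l => if ija.1 = l then Btil nu ns m ija.2 l else 0

/-- `[φ₂, …, φ_m]ᵀ (I - 1 1ᵀ / m) ⊗ I_{mn}` applied to `L_η`. -/
def Ldelta (nu ns : ℕ) (Φ : Matrix (Fin m) (Fin m) ℝ) :
    Matrix (Tail m × (Fin m × Ix nu ns)) (Fin m) ℝ :=
  (((tailCols Φ)ᵀ * ((1 : Matrix (Fin m) (Fin m) ℝ) - (m : ℝ)⁻¹ • vecMulVec 1 1)) ⊗ₖ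
    (1 : Matrix (Fin m × Ix nu ns) (Fin m × Ix nu ns) ℝ)) * Leta nu ns m

/-- `diag(S̃ - μ₂ B̃ Γ̃, …, S̃ - μ_m B̃ Γ̃)`. -/
def Adelta (μ : Fin m → ℝ) (S : Matrix (Ix nu ns) (Ix nu ns) ℝ) (Γ : Ix nu ns → ℝ) :
    Matrix (Tail m × (Fin m × Ix nu ns)) (Tail m × (Fin m × Ix nu ns)) ℝ :=
  (1 : Matrix (Tail m) (Tail m) ℝ) ⊗ₖ Stil m S
    - Matrix.diagonal (fun j : Tail m => μ j) ⊗ₖ (Btil nu ns m * Gtil m Γ)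

/-- System matrix of the reduced error dynamics. -/
def Ar (p : Plant nu ns m) (f : LocalFilter nu ns m) (Γ : Ix nu ns → ℝ) (μ : Fin m → ℝ)
    (Φ : Matrix (Fin m) (Fin m) ℝ) : Matrix (RIx nu ns m) (RIx nu ns m) ℝ :=
  fromBlocks (Adelta μ f.S Γ)
    (fromCols (Ldelta nu ns Φ * Gtil m f.β) (Ldelta nu ns Φ * p.C.toCols₂ * p.As))
    0
    (fromBlocks (Stil m f.Lam) (-(Btil nu ns m * p.C.toCols₂ * p.As)) 0 p.As)

/-- Input matrix of `w(k)`: the blocks are `L_δ C`, `col(G_i - 1 C_i)` with `G_i = [Gᵘ_i 0]`, and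
`J = [0 I]`. -/
def Bw (p : Plant nu ns m) (Φ : Matrix (Fin m) (Fin m) ℝ)
    (G : Fin m → Matrix (Ix nu ns) (Fin nu) ℝ) : Matrix (RIx nu ns m) (Ix nu ns) ℝ :=
  fromRows (Ldelta nu ns Φ * p.C)
    (fromRows (Matrix.of fun ia s => fromCols (G ia.1) 0 ia.2 s - p.C ia.1 s) (fromCols 0 1))

/-- Input matrix of `v(k+1)`. -/
def Bv (nu ns : ℕ) (Φ : Matrix (Fin m) (Fin m) ℝ) : Matrix (RIx nu ns m) (Fin m) ℝ :=
  fromRows (Ldelta nu ns Φ) (fromRows (-(Btil nu ns m)) 0)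

/-- Right-hand side `A_r X A_rᵀ + B_w Q B_wᵀ + B_v R B_vᵀ` of the Lyapunov equation. -/
def lyapRHS (p : Plant nu ns m) (f : LocalFilter nu ns m) (Γ : Ix nu ns → ℝ) (μ : Fin m → ℝ)
    (Φ : Matrix (Fin m) (Fin m) ℝ) (G : Fin m → Matrix (Ix nu ns) (Fin nu) ℝ)
    (X : Matrix (RIx nu ns m) (RIx nu ns m) ℝ) : Matrix (RIx nu ns m) (RIx nu ns m) ℝ :=
  Ar p f Γ μ Φ * X * (Ar p f Γ μ Φ)ᵀ + Bw p Φ G * p.Q * (Bw p Φ G)ᵀ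
    + Bv nu ns Φ * p.R * (Bv nu ns Φ)ᵀ

/-- The output matrix `(I_m ⊗ m F) [[φ₂, …, φ_m] ⊗ I, 0, 0]`. -/
def outMat (f : LocalFilter nu ns m) (Φ : Matrix (Fin m) (Fin m) ℝ) :
    Matrix (Fin m × Ix nu ns) (RIx nu ns m) ℝ :=
  ((1 : Matrix (Fin m) (Fin m) ℝ) ⊗ₖ ((m : ℝ) • f.bigF)) *
    fromCols (tailCols Φ ⊗ₖ (1 : Matrix (Fin m × Ix nu ns) (Fin m × Ix nu ns) ℝ)) 0

end DistKalman

end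

namespace DistKalman

/-! ### Schur matrices -/

section Schur

variable {ι κ : Type*} [Fintype ι] [DecidableEq ι] [Fintype κ] [DecidableEq κ]

/-! Since `S = Λ + 1βᵀ`, the local filter is the stable recursion `ξ_i(k+1) = Λ ξ_i(k) + 1
y_i(k+1)`. The relations `F_i Λ = (A - KCA) F_i` and `F_i 1 = K_i` then say that `F ξ` obeys the
Kalman recursion, so `x̂ = F ξ` exactly (`estimate_eq_bigF_mulVec`). Symmetric weights make the
coupling cancel in `∑ η_i`, which therefore equals `ξ` (`sum_eta`). Hence `mF` applied to the
average of the `η_i` is `x̂`, and a fused estimate differs from `x̂` only through the disagreement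
of `η_i` with the average. In Laplacian coordinates the disagreement evolves by `S̃ - μ_j B̃Γ̃`,
which the Riccati inequality makes Schur because `|1 - 2μ_j/(μ₂+μ_m)| ≤ ζ`
(`isSchur_sub_consensus`).

The disagreement is driven by the residuals `z_i`, and the state itself may grow. The matrices `G_i`
remove the unstable part: in terms of `ε_i = G_i x - ξ_i` and `xˢ`, the residuals no longer see `xᵘ`
(`resid_meas_eq`), and `ε` contracts by `Λ`. So (disagreement, `ε`, `xˢ`) is a Schur system driven
by white noise (`redState_succ`); its covariance converges to the unique Lyapunov solution, and `W̄`
is read off through the output matrix. The `G_i` come from a Sylvester equation with `Λ`;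
controllability of `(S, 1)` and `χ_S(Aᵘ) = 0` then force the output condition
(`existsUnique_intertwiner`).

Finally, `ξ` and `η` are linear in past measurements, hence uncorrelated with the Kalman error
(`IsObserved.filters`, the orthogonality principle). The error of a local estimate is its gap to
`x̂` plus the Kalman error common to all sensors, so the two covariances add. -/

theorem exists_eigenvector_of_mem_spectrum {M : Matrix ι ι ℂ} {z : ℂ} (hz : z ∈ spectrum ℂ M) :
    ∃ v : ι → ℂ, v ≠ 0 ∧ M *ᵥ v = z • v := by
  rw [← Matrix.spectrum_toLin', ← Module.End.hasEigenvalue_iff_mem_spectrum] at hz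
  obtain ⟨v, hv⟩ := hz.exists_hasEigenvector
  exact ⟨v, hv.2, by simpa using hv.apply_eq_smul⟩

theorem mem_spectrum_of_eigenvector {M : Matrix ι ι ℂ} {z : ℂ} {v : ι → ℂ} (hv : v ≠ 0)
    (h : M *ᵥ v = z • v) : z ∈ spectrum ℂ M := by
  rw [← Matrix.spectrum_toLin', ← Module.End.hasEigenvalue_iff_mem_spectrum]
  exact Module.End.hasEigenvalue_of_hasEigenvector (x := v)
    ⟨Module.End.mem_eigenspace_iff.2 (by simpa using h), hv⟩

theorem isSchur_iff {M : Matrix ι ι ℝ} : IsSchur M ↔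
    ∀ (z : ℂ) (v : ι → ℂ), v ≠ 0 → M.map (algebraMap ℝ ℂ) *ᵥ v = z • v → ‖z‖ < 1 :=
  ⟨fun h z _ hv hz => h z (mem_spectrum_of_eigenvector hv hz), fun h z hz => by
    obtain ⟨v, hv, hvz⟩ := exists_eigenvector_of_mem_spectrum hz
    exact h z v hv hvz⟩

/-- Gelfand's formula over `ℂ`: the spectral radius lies below some `r < 1`, so `‖N ^ k‖ ≤ r ^ k`
for large `k`. Entries of `M ^ k` are the real parts of those of `N ^ k`. -/
theorem IsSchur.tendsto_pow {M : Matrix ι ι ℝ} (h : IsSchur M) :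
    Tendsto (fun k : ℕ => M ^ k) atTop (𝓝 0) := by
  let _ := Matrix.linftyOpNormedRing (n := ι) (α := ℂ)
  let _ := Matrix.linftyOpNormedAlgebra (n := ι) (R := ℂ) (α := ℂ)
  rcases isEmpty_or_nonempty ι with hι | hι
  · exact tendsto_const_nhds.congr fun k => Subsingleton.elim _ _
  set N : Matrix ι ι ℂ := M.map (algebraMap ℝ ℂ)
  have hr : spectralRadius ℂ N < 1 := by
    have := spectrum.spectralRadius_lt_of_forall_lt N (r := 1) fun z hz => by
      have := h z hz
      exact_mod_cast this
    simpa using this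
  obtain ⟨r, hr₁, hr₂⟩ := exists_between hr
  have hr2 : r ≠ ⊤ := (hr₂.trans ENNReal.one_lt_top).ne
  lift r to NNReal using hr2
  have hN : Tendsto (fun k : ℕ => N ^ k) atTop (𝓝 0) := by
    refine tendsto_zero_iff_norm_tendsto_zero.2 ?_
    have hp : Tendsto (fun k : ℕ => (r : ℝ) ^ k) atTop (𝓝 0) :=
      tendsto_pow_atTop_nhds_zero_of_lt_one r.2 (by exact_mod_cast hr₂)
    refine squeeze_zero' (Eventually.of_forall fun k => norm_nonneg _) ?_ hp
    filter_upwards [(spectrum.pow_nnnorm_pow_one_div_tendsto_nhds_spectralRadius N).eventually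
      (gt_mem_nhds hr₁), eventually_gt_atTop 0] with k hk hk0
    have hk' : ((‖N ^ k‖₊ : ENNReal) ^ (1 / (k : ℝ))) ^ (k : ℝ) ≤ (r : ENNReal) ^ (k : ℝ) :=
      ENNReal.rpow_le_rpow hk.le (by positivity)
    rw [← ENNReal.rpow_mul, one_div, inv_mul_cancel₀ (by positivity), ENNReal.rpow_one,
      ENNReal.rpow_natCast] at hk'
    exact_mod_cast hk'
  refine tendsto_pi_nhds.2 fun i => tendsto_pi_nhds.2 fun j => ?_
  have h1 : Tendsto (fun k : ℕ => (N ^ k) i j) atTop (𝓝 0) :=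
    ((continuous_apply j).tendsto _).comp (((continuous_apply i).tendsto _).comp hN)
  have h2 : ∀ k : ℕ, ((M ^ k) i j) = ((N ^ k) i j).re := fun k => by
    have : N ^ k = (M ^ k).map (algebraMap ℝ ℂ) := (Matrix.map_pow M (algebraMap ℝ ℂ) k).symm
    simp [this]
  simp only [h2]
  exact (Complex.continuous_re.tendsto _).comp h1

/-- An eigenvector with nonzero lower half yields one of `D`; otherwise its upper half is one of
`A`. -/
theorem isSchur_fromBlocks_zero₂₁ {A : Matrix ι ι ℝ} {D : Matrix κ κ ℝ} (B : Matrix ι κ ℝ)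
    (hA : IsSchur A) (hD : IsSchur D) : IsSchur (fromBlocks A B 0 D) := by
  rw [isSchur_iff] at *
  intro z v hv h
  obtain ⟨u, t, rfl⟩ : ∃ u t, v = Sum.elim u t := ⟨_, _, (Sum.elim_comp_inl_inr v).symm⟩
  rw [fromBlocks_map, fromBlocks_mulVec] at h
  have h1 := congrArg (· ∘ Sum.inl) h
  have h2 := congrArg (· ∘ Sum.inr) h
  simp only [Sum.elim_comp_inl, Sum.elim_comp_inr, Matrix.map_zero _ (map_zero _),
    zero_mulVec, zero_add] at h1 h2
  by_cases ht : t = 0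
  · subst ht
    refine hA z u (fun hu => hv ?_) (by rw [mulVec_zero, add_zero] at h1; exact h1)
    subst hu
    ext (i | i) <;> rfl
  · exact hD z t ht h2

/-- A matrix on a product index set that acts fibrewise by Schur matrices is Schur. -/
theorem isSchur_of_fibrewise {T : Matrix (κ × ι) (κ × ι) ℝ} {A : κ → Matrix ι ι ℝ}
    (hT : ∀ j i j' i', T (j, i) (j', i') = if j = j' then A j i i' else 0)
    (hA : ∀ j, IsSchur (A j)) : IsSchur T := by
  simp only [isSchur_iff] at *
  intro z v hv h
  obtain ⟨⟨j, i⟩, hji⟩ := Function.ne_iff.1 hv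
  refine hA j z (fun i => v (j, i)) (fun h0 => hji (congrFun h0 i)) ?_
  ext i
  have := congrFun h (j, i)
  simp only [mulVec, dotProduct, Matrix.map_apply, hT, Fintype.sum_prod_type, Pi.smul_apply]
    at this ⊢
  rw [← this, Finset.sum_eq_single j]
  · simp
  · intro b _ hb
    simp [Ne.symm hb]
  · simp

/-- Lyapunov's criterion. -/
theorem isSchur_of_quadForm_lt {A M : Matrix ι ι ℝ} (hM : ∀ x, 0 ≤ x ⬝ᵥ M *ᵥ x)
    (h : ∀ x, x ≠ 0 → (A *ᵥ x) ⬝ᵥ M *ᵥ (A *ᵥ x) < x ⬝ᵥ M *ᵥ x) : IsSchur A := by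
  rw [isSchur_iff]
  intro z v hv hz
  -- For a complex eigenvector `a + ib`, passing to `A` multiplies the sum of the two real quadratic
  -- forms at `a` and `b` by exactly `‖z‖²`. That sum strictly decreases, since `a` and `b` are not
  -- both zero.
  set a : ι → ℝ := fun i => (v i).re
  set b : ι → ℝ := fun i => (v i).im
  have ha : A *ᵥ a = z.re • a - z.im • b := by
    ext i
    have := congrArg Complex.re (congrFun hz i)
    simpa [mulVec, dotProduct, a, b] using this
  have hb : A *ᵥ b = z.re • b + z.im • a := by
    ext i
    have := congrArg Complex.im (congrFun hz i)
    simpa [mulVec, dotProduct, a, b] using this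
  have hle : ∀ x, (A *ᵥ x) ⬝ᵥ M *ᵥ (A *ᵥ x) ≤ x ⬝ᵥ M *ᵥ x := fun x => by
    by_cases hx : x = 0
    · simp [hx]
    · exact (h x hx).le
  have hlt : (A *ᵥ a) ⬝ᵥ M *ᵥ (A *ᵥ a) + (A *ᵥ b) ⬝ᵥ M *ᵥ (A *ᵥ b)
      < a ⬝ᵥ M *ᵥ a + b ⬝ᵥ M *ᵥ b := by
    by_cases ha0 : a = 0
    · have hb0 : b ≠ 0 := fun hb0 => hv (by
        ext i
        exact Complex.ext (congrFun ha0 i) (congrFun hb0 i))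
      exact add_lt_add_of_le_of_lt (hle a) (h b hb0)
    · exact add_lt_add_of_lt_of_le (h a ha0) (hle b)
  have heq : (A *ᵥ a) ⬝ᵥ M *ᵥ (A *ᵥ a) + (A *ᵥ b) ⬝ᵥ M *ᵥ (A *ᵥ b)
      = (z.re ^ 2 + z.im ^ 2) * (a ⬝ᵥ M *ᵥ a + b ⬝ᵥ M *ᵥ b) := by
    rw [ha, hb]
    simp only [mulVec_sub, mulVec_add, mulVec_smul, dotProduct_sub, dotProduct_add, sub_dotProduct,
      add_dotProduct, smul_dotProduct, dotProduct_smul, smul_eq_mul]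
    ring
  have hq : 0 ≤ a ⬝ᵥ M *ᵥ a + b ⬝ᵥ M *ᵥ b := add_nonneg (hM a) (hM b)
  have hz2 : ‖z‖ ^ 2 < 1 := by
    rw [Complex.sq_norm, Complex.normSq_apply]
    nlinarith
  nlinarith [norm_nonneg z]

end Schur

/-! ### The discrete Lyapunov equation -/

section Lyapunov

variable {ι : Type*} [Fintype ι] [DecidableEq ι]

theorem tendsto_pow_mul_mul_pow_transpose {A : Matrix ι ι ℝ} (hA : IsSchur A) (X : Matrix ι ι ℝ) :
    Tendsto (fun k : ℕ => A ^ k * X * (A ^ k)ᵀ) atTop (𝓝 0) := by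
  have h := hA.tendsto_pow
  have hc : Continuous fun B : Matrix ι ι ℝ => B * X * Bᵀ := by fun_prop
  have h0 := (hc.tendsto 0).comp h
  rw [Matrix.zero_mul, Matrix.zero_mul] at h0
  exact h0

theorem eq_pow_mul_mul_pow_transpose {A : Matrix ι ι ℝ} {D : ℕ → Matrix ι ι ℝ}
    (hD : ∀ k, D (k + 1) = A * D k * Aᵀ) (k : ℕ) : D k = A ^ k * D 0 * (A ^ k)ᵀ := by
  induction k with
  | zero => simp
  | succ k ih => rw [hD, ih, pow_succ', transpose_mul]; simp only [Matrix.mul_assoc]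

/-- By finite dimensionality, injectivity of `X ↦ X - A X Aᵀ` suffices. A kernel element equals `A ^
k X (A ^ k)ᵀ` for every `k`, and this tends to `0`. -/
theorem existsUnique_lyapunov {A : Matrix ι ι ℝ} (hA : IsSchur A) (N : Matrix ι ι ℝ) :
    ∃ W, ∀ X, X = A * X * Aᵀ + N ↔ X = W := by
  let T : Matrix ι ι ℝ →ₗ[ℝ] Matrix ι ι ℝ :=
    LinearMap.id - (LinearMap.mulRight ℝ Aᵀ) ∘ₗ (LinearMap.mulLeft ℝ A)
  have hT : ∀ X, T X = X - A * X * Aᵀ := fun X => rfl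
  have hinj : Function.Injective T := by
    rw [← LinearMap.ker_eq_bot, LinearMap.ker_eq_bot']
    intro X hX
    rw [hT, sub_eq_zero] at hX
    have := eq_pow_mul_mul_pow_transpose (D := fun _ => X) (A := A) fun _ => hX
    exact tendsto_nhds_unique (tendsto_const_nhds.congr this)
      (tendsto_pow_mul_mul_pow_transpose hA X)
  obtain ⟨W, hW⟩ := (LinearMap.injective_iff_surjective.1 hinj) N
  refine ⟨W, fun X => ?_⟩
  rw [← hinj.eq_iff (a := X) (b := W), hW, hT, sub_eq_iff_eq_add']

theorem tendsto_lyapunov_iterate {A : Matrix ι ι ℝ} (hA : IsSchur A) {N W : Matrix ι ι ℝ}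
    (hW : W = A * W * Aᵀ + N) {V : ℕ → Matrix ι ι ℝ} (hV : ∀ k, V (k + 1) = A * V k * Aᵀ + N) :
    Tendsto V atTop (𝓝 W) := by
  have h := eq_pow_mul_mul_pow_transpose (A := A) (D := fun k => V k - W) fun k => by
    simp only [Matrix.mul_sub, Matrix.sub_mul]
    nth_rewrite 1 [hV, hW]
    abel
  have h0 := (tendsto_pow_mul_mul_pow_transpose hA (V 0 - W)).congr fun k => (h k).symm
  simpa using h0.add_const W

end Lyapunov

/-! ### Intertwining equations -/

section Intertwining

variable {ι κ : Type*} [Fintype ι] [DecidableEq ι] [Fintype κ] [DecidableEq κ]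

theorem aeval_charpoly_eq_zero_iff (M : Matrix ι ι ℝ) (z : ℂ) :
    Polynomial.aeval z M.charpoly = 0 ↔ z ∈ spectrum ℂ (M.map (algebraMap ℝ ℂ)) := by
  rw [Matrix.mem_spectrum_iff_isRoot_charpoly, Matrix.charpoly_map, Polynomial.IsRoot,
    Polynomial.eval_map_algebraMap]

theorem isCoprime_charpoly {M : Matrix ι ι ℝ} {N : Matrix κ κ ℝ}
    (h : Disjoint (spectrum ℂ (M.map (algebraMap ℝ ℂ))) (spectrum ℂ (N.map (algebraMap ℝ ℂ)))) :
    IsCoprime M.charpoly N.charpoly := by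
  refine (Polynomial.isCoprime_iff_aeval_ne_zero_of_isAlgClosed ℝ ℂ _ _).2 ?_
  intro z
  by_contra! hz
  rw [aeval_charpoly_eq_zero_iff, aeval_charpoly_eq_zero_iff] at hz
  exact Set.disjoint_left.1 h hz.1 hz.2

theorem aeval_mul_of_intertwines {M : Matrix ι ι ℝ} {N : Matrix κ κ ℝ} {G : Matrix ι κ ℝ}
    (h : M * G = G * N) (q : Polynomial ℝ) :
    Polynomial.aeval M q * G = G * Polynomial.aeval N q := by
  have hpow : ∀ k : ℕ, M ^ k * G = G * N ^ k := fun k => by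
    induction k with
    | zero => simp
    | succ k ih => rw [pow_succ, Matrix.mul_assoc, h, ← Matrix.mul_assoc, ih, pow_succ,
        Matrix.mul_assoc]
  induction q using Polynomial.induction_on' with
  | add p q hp hq => simp [Matrix.add_mul, Matrix.mul_add, hp, hq]
  | monomial k c =>
    simp [Polynomial.aeval_monomial, Algebra.algebraMap_eq_smul_one, hpow]

/-- `G χ_M(N) = χ_M(M) G = 0` by Cayley–Hamilton, and the Bézout identity evaluated at `N` makes
`χ_M(N)` invertible. -/
theorem eq_zero_of_intertwines {M : Matrix ι ι ℝ} {N : Matrix κ κ ℝ}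
    (hco : IsCoprime M.charpoly N.charpoly) {G : Matrix ι κ ℝ} (h : M * G = G * N) : G = 0 := by
  obtain ⟨a, b, hab⟩ := hco
  have h1 : G * Polynomial.aeval N M.charpoly = 0 := by
    rw [← aeval_mul_of_intertwines h, Matrix.aeval_self_charpoly, Matrix.zero_mul]
  have h2 := congrArg (Polynomial.aeval N) hab
  rw [map_add, map_mul, map_mul, Matrix.aeval_self_charpoly, mul_zero, add_zero, map_one,
    ← map_mul, mul_comm, map_mul] at h2
  rw [← Matrix.mul_one G, ← h2, ← Matrix.mul_assoc, h1, Matrix.zero_mul]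

theorem exists_sylvester {M : Matrix ι ι ℝ} {N : Matrix κ κ ℝ}
    (hco : IsCoprime M.charpoly N.charpoly) (D : Matrix ι κ ℝ) :
    ∃ G : Matrix ι κ ℝ, M * G - G * N = D := by
  let T : Matrix ι κ ℝ →ₗ[ℝ] Matrix ι κ ℝ :=
    { toFun := fun G => M * G - G * N
      map_add' := fun _ _ => by simp only [Matrix.mul_add, Matrix.add_mul]; abel
      map_smul' := fun _ _ => by simp [smul_sub] }
  have hinj : Function.Injective T := by
    rw [← LinearMap.ker_eq_bot, LinearMap.ker_eq_bot']
    exact fun X hX => eq_zero_of_intertwines hco (sub_eq_zero.1 hX)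
  exact LinearMap.injective_iff_surjective.1 hinj D

/-- If `M + b cᵀ` and `M` have no common eigenvalue, the pair `(M + b cᵀ, b)` is controllable. -/
theorem linearIndependent_pow_mulVec {M S : Matrix ι ι ℝ} {b c : ι → ℝ}
    (hS : S = M + vecMulVec b c) (hco : IsCoprime S.charpoly M.charpoly) :
    LinearIndependent ℝ fun k : Fin (Fintype.card ι) => S ^ (k : ℕ) *ᵥ b := by
  -- With `n` vectors in dimension `n`, spanning is enough. If it fails, a nonzero row `r` kills
  -- every `S ^ k b`, all powers being reduced modulo `χ_S`.
  refine linearIndependent_of_top_le_span_of_card_eq_finrank ?_ (by simp)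
  by_contra hspan
  set W := Submodule.span ℝ (Set.range fun k : Fin (Fintype.card ι) => S ^ (k : ℕ) *ᵥ b)
  obtain ⟨φ, hφ, hφW⟩ := Submodule.exists_le_ker_of_lt_top W (lt_top_iff_ne_top.2
    fun h => hspan (h ▸ le_rfl))
  have hpoly : ∀ q : Polynomial ℝ, Polynomial.aeval S q *ᵥ b ∈ W := fun q => by
    rw [Matrix.aeval_eq_aeval_mod_charpoly, Polynomial.aeval_eq_sum_range]
    rw [sum_mulVec]
    refine Submodule.sum_mem _ fun k hk => ?_
    rw [smul_mulVec]
    rcases Nat.lt_or_ge k (Fintype.card ι) with hk' | hk'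
    · exact Submodule.smul_mem _ _ (Submodule.subset_span ⟨⟨k, hk'⟩, rfl⟩)
    · rw [Polynomial.coeff_eq_zero_of_degree_lt, zero_smul]
      · exact Submodule.zero_mem _
      · refine (Polynomial.degree_modByMonic_lt _ S.charpoly_monic).trans_le ?_
        rw [Matrix.charpoly_degree_eq_dim]
        exact_mod_cast hk'
  obtain ⟨r, rfl⟩ := (dotProductEquiv ℝ ι).surjective φ
  have hφr : ∀ x, dotProductEquiv ℝ ι r x = r ⬝ᵥ x := fun x => rfl
  have hzero : ∀ k : ℕ, r ᵥ* S ^ k ⬝ᵥ b = 0 := fun k => by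
    rw [← dotProduct_mulVec, ← hφr]
    have := hφW (hpoly (Polynomial.X ^ k))
    simpa using this
  -- The term `b cᵀ` is invisible to `r S ^ k`, so `r q(S) = r q(M)` for every polynomial `q`. In
  -- particular `r χ_M(S) = 0`, while coprimality makes `χ_M(S)` invertible.
  have hrow : ∀ k : ℕ, r ᵥ* S ^ k = r ᵥ* M ^ k := fun k => by
    induction k with
    | zero => simp
    | succ k ih =>
      have := hzero k
      rw [pow_succ, ← vecMul_vecMul, hS, vecMul_add, ← hS, vecMul_vecMulVec, this, zero_smul,
        add_zero, ih, vecMul_vecMul, ← pow_succ]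
  have hrowp : ∀ q : Polynomial ℝ, r ᵥ* Polynomial.aeval S q = r ᵥ* Polynomial.aeval M q :=
    fun q => by
      induction q using Polynomial.induction_on' with
      | add p q hp hq => simp [vecMul_add, hp, hq]
      | monomial k d =>
        simp [Polynomial.aeval_monomial, Algebra.algebraMap_eq_smul_one, hrow, vecMul_smul]
  obtain ⟨d, e, hde⟩ := hco
  have h1 := congrArg (Polynomial.aeval S) hde
  rw [map_add, map_mul, map_mul, Matrix.aeval_self_charpoly, mul_zero, zero_add, map_one,
    ← map_mul, mul_comm, map_mul] at h1
  have h2 : r = 0 := by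
    rw [← vecMul_one r, ← h1, ← vecMul_vecMul, hrowp, Matrix.aeval_self_charpoly, vecMul_zero,
      zero_vecMul]
  exact hφ (LinearMap.ext fun x => by simp [h2])

/-- If the characteristic polynomial of `S` annihilates `N`, the pair `(S, b)` is controllable, and
`S G - G N` has the form `b dᵀ`, then `S G = G N`. -/
theorem eq_zero_of_sub_eq_vecMulVec {S : Matrix ι ι ℝ} {N : Matrix κ κ ℝ} {b : ι → ℝ}
    (hind : LinearIndependent ℝ fun k : Fin (Fintype.card ι) => S ^ (k : ℕ) *ᵥ b)
    (hN : Polynomial.aeval N S.charpoly = 0) {G : Matrix ι κ ℝ} {d : κ → ℝ} [Nonempty ι]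
    (h : S * G - G * N = vecMulVec b d) : d = 0 := by
  set n := Fintype.card ι with hn
  -- Telescoping the defect `b dᵀ`. Weighting with the coefficients of `χ_S` and summing then gives
  -- zero, because `χ_S` kills both `S` and `N`.
  have hpow : ∀ k : ℕ, S ^ k * G - G * N ^ k
      = ∑ j ∈ Finset.range k, vecMulVec (S ^ j *ᵥ b) (d ᵥ* N ^ (k - 1 - j)) := fun k => by
    induction k with
    | zero => simp
    | succ k ih =>
      have : S ^ (k + 1) * G - G * N ^ (k + 1)
          = S ^ k * (S * G - G * N) + (S ^ k * G - G * N ^ k) * N := by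
        simp only [pow_succ, Matrix.mul_sub, Matrix.sub_mul, Matrix.mul_assoc]
        abel
      rw [this, h, ih, Finset.sum_range_succ, add_comm, Matrix.sum_mul]
      congr 1
      · refine Finset.sum_congr rfl fun j hj => ?_
        have hj' := Finset.mem_range.1 hj
        rw [vecMulVec_mul, vecMul_vecMul, ← pow_succ]
        congr 3
        omega
      · simp [mul_vecMulVec]
  have hsum : ∑ k ∈ Finset.range (n + 1), S.charpoly.coeff k • (S ^ k * G - G * N ^ k) = 0 := by
    have h1 := S.aeval_self_charpoly
    have h2 := hN
    rw [Polynomial.aeval_eq_sum_range, Matrix.charpoly_natDegree_eq_dim] at h1 h2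
    have h3 : ∀ k, S.charpoly.coeff k • (S ^ k * G - G * N ^ k)
        = (S.charpoly.coeff k • S ^ k) * G - G * (S.charpoly.coeff k • N ^ k) := fun k => by
      rw [smul_sub, Matrix.smul_mul, Matrix.mul_smul]
    simp only [h3, Finset.sum_sub_distrib, ← Matrix.sum_mul, ← Matrix.mul_sum]
    rw [hn, h1, h2, Matrix.zero_mul, Matrix.mul_zero, sub_zero]
  have hn0 : 0 < n := Fintype.card_pos
  -- The dual vector to `S ^ (n-1) b`. In the weighted sum only `k = n`, `j = n - 1` survives it;
  -- there the coefficient is `1` (monic) and the power of `N` is `0`, leaving `d` alone.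
  obtain ⟨r, hr⟩ : ∃ r : ι → ℝ, ∀ j < n, r ⬝ᵥ (S ^ j *ᵥ b) = if j = n - 1 then 1 else 0 := by
    have : Nonempty (Fin n) := ⟨⟨0, hn0⟩⟩
    let B := basisOfLinearIndependentOfCardEqFinrank hind (by simp [hn])
    obtain ⟨r, hr⟩ := (dotProductEquiv ℝ ι).surjective (B.coord ⟨n - 1, by omega⟩)
    refine ⟨r, fun j hj => ?_⟩
    have h1 : S ^ j *ᵥ b = B ⟨j, hj⟩ := by simp [B]
    have h2 : r ⬝ᵥ (S ^ j *ᵥ b) = B.coord ⟨n - 1, by omega⟩ (S ^ j *ᵥ b) := by rw [← hr]; rfl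
    rw [h2, h1, Module.Basis.coord_apply, Module.Basis.repr_self, Finsupp.single_apply]
    simp [Fin.ext_iff]
  have hterm : ∀ k ∈ Finset.range (n + 1),
      r ᵥ* (S.charpoly.coeff k • (S ^ k * G - G * N ^ k)) = if k = n then d else 0 := by
    intro k hk
    have hk' := Finset.mem_range.1 hk
    rw [vecMul_smul, hpow, Matrix.vecMul_sum]
    have h1 : ∀ j ∈ Finset.range k, r ᵥ* vecMulVec (S ^ j *ᵥ b) (d ᵥ* N ^ (k - 1 - j))
        = if j = n - 1 then d ᵥ* N ^ (k - 1 - j) else 0 := fun j hj => by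
      have hj' := Finset.mem_range.1 hj
      rw [vecMul_vecMulVec, hr j (by omega), ite_smul, one_smul, zero_smul]
    rw [Finset.sum_congr rfl h1, Finset.sum_ite_eq']
    by_cases hkn : k = n
    · subst hkn
      have hc : S.charpoly.coeff n = 1 := by
        have := S.charpoly_monic
        rwa [Polynomial.Monic, Polynomial.leadingCoeff, Matrix.charpoly_natDegree_eq_dim] at this
      rw [if_pos (by simp; omega), hc]
      simp
    · rw [if_neg (by simp; omega), if_neg hkn, smul_zero]
  have := congrArg (r ᵥ* ·) hsum
  simp only [Matrix.vecMul_sum, vecMul_zero] at this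
  rw [Finset.sum_congr rfl hterm, Finset.sum_ite_eq', if_pos (by simp)] at this
  exact this

/-- The equations `S G = G N`, `cᵀ G = d` have a unique solution when `S = M + b cᵀ`, `M` shares
eigenvalues neither with `S` nor with `N`, and the characteristic polynomial of `S` annihilates
`N`. -/
theorem existsUnique_intertwiner {M S : Matrix ι ι ℝ} {N : Matrix κ κ ℝ} {b c : ι → ℝ}
    (hS : S = M + vecMulVec b c) (hSM : IsCoprime S.charpoly M.charpoly)
    (hMN : IsCoprime M.charpoly N.charpoly) (hN : Polynomial.aeval N S.charpoly = 0) (d : κ → ℝ) :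
    ∃ G, ∀ G', (S * G' = G' * N ∧ c ᵥ* G' = d) ↔ G' = G := by
  have hmul : ∀ G' : Matrix ι κ ℝ, S * G' = M * G' + vecMulVec b (c ᵥ* G') := fun G' => by
    rw [hS, Matrix.add_mul, vecMulVec_mul]
  -- Substituting `c G = d` into `S G = G N` leaves a Sylvester equation with `M`, which determines
  -- `G`. Conversely, its solution has intertwining defect `b (c G - d)`, and controllability forces
  -- this to vanish.
  obtain ⟨G, hG⟩ := exists_sylvester hMN (-vecMulVec b d)
  have hSG : S * G - G * N = vecMulVec b (c ᵥ* G - d) := by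
    rw [hmul, add_sub_right_comm, hG, vecMulVec_sub]
    abel
  have hc : c ᵥ* G = d := by
    -- With `ι` empty, `χ_S = 1` annihilates `N`, so `κ` is empty too.
    rcases isEmpty_or_nonempty ι with hι | hι
    · have h1 : S.charpoly = 1 := by simp [Matrix.charpoly]
      rw [h1, map_one] at hN
      ext k
      have hk : (1 : Matrix κ κ ℝ) k k = 0 := by rw [hN]; rfl
      simp at hk
    · exact sub_eq_zero.1 (eq_zero_of_sub_eq_vecMulVec (linearIndependent_pow_mulVec hS hSM) hN hSG)
  refine ⟨G, fun G' => ⟨fun ⟨h1, h2⟩ => ?_, ?_⟩⟩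
  · refine sub_eq_zero.1 (eq_zero_of_intertwines hMN ?_)
    rw [hmul, h2] at h1
    rw [Matrix.mul_sub, Matrix.sub_mul, ← h1, eq_add_of_sub_eq hG]
    abel
  · rintro rfl
    exact ⟨by
      rw [hc, sub_self, show vecMulVec b (0 : κ → ℝ) = 0 by ext; simp [vecMulVec_apply]] at hSG
      exact sub_eq_zero.1 hSG, hc⟩

end Intertwining

/-! ### Laplacian eigenvalues -/

section Laplacian

variable {m : ℕ} {a : Matrix (Fin m) (Fin m) ℝ}

theorem laplacian_mulVec_apply (x : Fin m → ℝ) (i : Fin m) :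
    (laplacian a *ᵥ x) i = ∑ j, a i j * (x i - x j) := by
  rw [laplacian, sub_mulVec, Pi.sub_apply, mulVec_diagonal]
  simp only [mulVec, dotProduct, mul_sub, Finset.sum_sub_distrib, Finset.sum_mul]

theorem two_mul_laplacian_quadForm (ha : IsNetwork a) (x : Fin m → ℝ) :
    2 * (x ⬝ᵥ laplacian a *ᵥ x) = ∑ i, ∑ j, a i j * (x i - x j) ^ 2 := by
  have h1 : x ⬝ᵥ laplacian a *ᵥ x = ∑ i, ∑ j, a i j * (x i * (x i - x j)) := by
    simp only [dotProduct, laplacian_mulVec_apply, Finset.mul_sum]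
    exact Finset.sum_congr rfl fun i _ => Finset.sum_congr rfl fun j _ => by ring
  have h2 : x ⬝ᵥ laplacian a *ᵥ x = ∑ i, ∑ j, a i j * (x j * (x j - x i)) := by
    rw [h1, Finset.sum_comm]
    exact Finset.sum_congr rfl fun i _ => Finset.sum_congr rfl fun j _ => by rw [ha.symm]
  rw [two_mul]
  nth_rewrite 1 [h1]
  rw [h2, ← Finset.sum_add_distrib]
  refine Finset.sum_congr rfl fun i _ => ?_
  rw [← Finset.sum_add_distrib]
  exact Finset.sum_congr rfl fun j _ => by ring

theorem laplacian_quadForm_nonneg (ha : IsNetwork a) (x : Fin m → ℝ) :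
    0 ≤ x ⬝ᵥ laplacian a *ᵥ x := by
  have : 0 ≤ ∑ i, ∑ j, a i j * (x i - x j) ^ 2 :=
    Finset.sum_nonneg fun i _ => Finset.sum_nonneg fun j _ =>
      mul_nonneg (ha.nonneg i j) (sq_nonneg _)
  linarith [two_mul_laplacian_quadForm ha x]

/-- Every term `a i j (x i - x j)²` vanishes, so `x` agrees across edges and hence along walks. -/
theorem eq_of_laplacian_quadForm_eq_zero (ha : IsNetwork a) {x : Fin m → ℝ}
    (hx : x ⬝ᵥ laplacian a *ᵥ x = 0) (i j : Fin m) : x i = x j := by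
  have hsum : ∑ i, ∑ j, a i j * (x i - x j) ^ 2 = 0 := by
    rw [← two_mul_laplacian_quadForm ha, hx, mul_zero]
  have hterm : ∀ i j, a i j * (x i - x j) ^ 2 = 0 := fun i j => by
    rw [Finset.sum_eq_zero_iff_of_nonneg fun i _ => Finset.sum_nonneg fun j _ =>
      mul_nonneg (ha.nonneg i j) (sq_nonneg _)] at hsum
    have := hsum i (Finset.mem_univ _)
    rw [Finset.sum_eq_zero_iff_of_nonneg fun j _ =>
      mul_nonneg (ha.nonneg i j) (sq_nonneg _)] at this
    exact this j (Finset.mem_univ _)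
  have hpos : ∀ i j, 0 < a i j → x i = x j := fun i j hij => by
    rcases mul_eq_zero.1 (hterm i j) with h | h
    · exact absurd h hij.ne'
    · exact sub_eq_zero.1 (pow_eq_zero_iff (two_ne_zero) |>.1 h)
  obtain ⟨p⟩ := ha.connected.preconnected i j
  induction p with
  | nil => rfl
  | cons h _ ih =>
    refine Eq.trans ?_ ih
    rw [SimpleGraph.fromRel_adj] at h
    exact h.2.elim (hpos _ _) fun h => (hpos _ _ h).symm

variable {μ : Fin m → ℝ} {Φ : Matrix (Fin m) (Fin m) ℝ}

theorem IsLapDiag.mul_transpose (h : IsLapDiag a μ Φ) : Φ * Φᵀ = 1 :=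
  mul_eq_one_comm.1 h.orth

theorem IsLapDiag.transpose_mul_laplacian (h : IsLapDiag a μ Φ) :
    Φᵀ * laplacian a = diagonal μ * Φᵀ := by
  rw [← h.diag, Matrix.mul_assoc _ Φ, h.mul_transpose, Matrix.mul_one]

theorem IsLapDiag.sum_tail_eq_zero (h : IsLapDiag a μ Φ) (j : Tail m) : ∑ i, Φ i j = 0 := by
  have hm : 0 < m := j.1.pos
  have h0 := congrFun (congrFun h.orth ⟨0, hm⟩) j
  rw [Matrix.mul_apply, Matrix.one_apply_ne (fun h' => j.2 (by rw [← h']))] at h0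
  simp only [transpose_apply, h.first _ ⟨0, hm⟩ rfl, ← Finset.mul_sum] at h0
  rcases mul_eq_zero.1 h0 with h1 | h1
  · have : (0 : ℝ) < 1 / √(m : ℝ) := by positivity
    exact absurd h1 this.ne'
  · exact h1

/-- At eigenvalue zero the column would be constant by connectedness. It is orthogonal to the
all-ones direction, so it would vanish, against its unit norm. -/
theorem IsLapDiag.eigenvalue_pos (ha : IsNetwork a) (h : IsLapDiag a μ Φ) (j : Tail m) :
    0 < μ j := by
  set x : Fin m → ℝ := fun i => Φ i j
  have hμ : x ⬝ᵥ laplacian a *ᵥ x = μ j := by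
    have := congrFun (congrFun h.diag j) j
    rw [diagonal_apply_eq, Matrix.mul_assoc] at this
    rw [← this]
    rfl
  have hx : x ⬝ᵥ x = 1 := by
    have := congrFun (congrFun h.orth j) j
    rwa [Matrix.one_apply_eq] at this
  refine lt_of_le_of_ne (hμ ▸ laplacian_quadForm_nonneg ha x) fun h0 => ?_
  have hconst := eq_of_laplacian_quadForm_eq_zero ha (hμ.trans h0.symm)
  have hsum : x ⬝ᵥ x = x j * ∑ i, x i := by
    rw [dotProduct, Finset.mul_sum]
    exact Finset.sum_congr rfl fun i _ => by rw [hconst i j]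
  rw [h.sum_tail_eq_zero, mul_zero, hx] at hsum
  exact one_ne_zero hsum

theorem IsLapDiag.tailCols_transpose_mul_one (h : IsLapDiag a μ Φ) :
    (tailCols Φ)ᵀ * (vecMulVec 1 1 : Matrix (Fin m) (Fin m) ℝ) = 0 := by
  ext j i
  rw [Matrix.mul_apply]
  simpa only [tailCols, vecMulVec_apply, transpose_apply, submatrix_apply, Pi.one_apply, mul_one,
    id, Matrix.zero_apply] using h.sum_tail_eq_zero j

theorem IsLapDiag.tailCols_transpose_mul_laplacian (h : IsLapDiag a μ Φ) :
    (tailCols Φ)ᵀ * laplacian a = diagonal (fun j : Tail m => μ j) * (tailCols Φ)ᵀ := by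
  ext j i
  have := congrFun (congrFun h.transpose_mul_laplacian j) i
  rw [diagonal_mul] at this ⊢
  exact this

theorem IsLapDiag.tailCols_mul_transpose (h : IsLapDiag a μ Φ) :
    tailCols Φ * (tailCols Φ)ᵀ = 1 - (m : ℝ)⁻¹ • vecMulVec 1 1 := by
  rw [← h.mul_transpose]
  ext i l
  have hm : 0 < m := i.pos
  have hsplit : ∑ j, Φ i j * Φ l j
      = Φ i ⟨0, hm⟩ * Φ l ⟨0, hm⟩ + ∑ j : Tail m, Φ i j * Φ l j := by
    rw [← Fintype.sum_subtype_add_sum_subtype (fun j : Fin m => (j : ℕ) ≠ 0), add_comm]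
    congr 1
    refine Fintype.sum_eq_single (⟨⟨0, hm⟩, by simp⟩ : {j : Fin m // ¬(j : ℕ) ≠ 0}) fun j hj => ?_
    exact absurd (Subtype.ext (Fin.ext (not_not.1 j.2))) hj
  have hsq : 1 / √(m : ℝ) * (1 / √(m : ℝ)) = (m : ℝ)⁻¹ := by
    rw [div_mul_div_comm, Real.mul_self_sqrt (by positivity), one_mul, one_div]
  rw [h.first _ ⟨0, hm⟩ rfl, h.first _ ⟨0, hm⟩ rfl, hsq] at hsplit
  rw [Matrix.sub_apply, Matrix.smul_apply, vecMulVec_apply, Matrix.mul_apply, Matrix.mul_apply]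
  simp only [transpose_apply, tailCols, submatrix_apply, id, hsplit, Pi.one_apply, mul_one,
    smul_eq_mul, add_sub_cancel_left]

end Laplacian

/-! ### The consensus gain -/

section ConsensusGain

variable {nu ns m : ℕ}

theorem onesForm_nonneg {M : Matrix (Ix nu ns) (Ix nu ns) ℝ} (hM : M.PosDef) : 0 ≤ onesForm M := by
  simpa [onesForm] using hM.posSemidef.dotProduct_mulVec_nonneg 1

/-- `M` is a Lyapunov function. With `u = S x`, `g = 1ᵀ M u`, `t = 1/(1ᵀ M 1)`, the closed-loop form
is `uᵀ M u - (1 - (1-c)²) t g²`. This is at most `uᵀ M u - (1 - ζ²) t g²`, which the Riccati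
inequality puts below `xᵀ M x`. -/
theorem isSchur_sub_consensus {M S : Matrix (Ix nu ns) (Ix nu ns) ℝ} {ζ : ℝ} (hM : M.PosDef)
    (hric : RiccatiIneq ζ M S) {c : ℝ} (hc : (1 - c) ^ 2 ≤ ζ ^ 2) :
    IsSchur (S - vecMulVec 1 ((c * (onesForm M)⁻¹) • ((1 : Ix nu ns → ℝ) ᵥ* (M * S)))) := by
  have hsymm : Mᵀ = M := hM.1
  refine isSchur_of_quadForm_lt (M := M)
    (fun x => by simpa using hM.posSemidef.dotProduct_mulVec_nonneg x) fun x hx => ?_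
  set t := (onesForm M)⁻¹ with ht
  have ht0 : 0 ≤ t := inv_nonneg.2 (onesForm_nonneg hM)
  set u := S *ᵥ x with hu
  set g := (1 : Ix nu ns → ℝ) ⬝ᵥ M *ᵥ u with hg
  have hg' : u ⬝ᵥ M *ᵥ (1 : Ix nu ns → ℝ) = g := by
    rw [dotProduct_mulVec, ← mulVec_transpose, hsymm, dotProduct_comm]
  have hgx : ((1 : Ix nu ns → ℝ) ᵥ* (M * S)) ⬝ᵥ x = g := by
    rw [← dotProduct_mulVec, ← mulVec_mulVec]
  have h1 : (S - vecMulVec 1 ((c * t) • ((1 : Ix nu ns → ℝ) ᵥ* (M * S)))) *ᵥ x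
      = u - (c * t * g) • (1 : Ix nu ns → ℝ) := by
    rw [sub_mulVec, vecMulVec_mulVec, smul_dotProduct, hgx, op_smul_eq_smul, smul_eq_mul]
  have h2 := hric.dotProduct_mulVec_pos hx
  have h3 : x ⬝ᵥ (Sᵀ * M * S) *ᵥ x = u ⬝ᵥ M *ᵥ u := by
    rw [← mulVec_mulVec, ← mulVec_mulVec, dotProduct_mulVec, vecMul_transpose]
  have h4 : x ⬝ᵥ (Sᵀ * M * vecMulVec 1 1 * M * S) *ᵥ x = g ^ 2 := by
    rw [← mulVec_mulVec, ← mulVec_mulVec, ← mulVec_mulVec, ← mulVec_mulVec, vecMulVec_mulVec,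
      dotProduct_mulVec, vecMul_transpose]
    simp only [op_smul_eq_smul, mulVec_smul, dotProduct_smul, smul_eq_mul]
    rw [← hu, ← hg, hg']
    ring
  -- The convention `0⁻¹ = 0` covers a state space of dimension zero, where `1ᵀ M 1 = 0`.
  have htt : t ^ 2 * onesForm M = t := by
    rcases eq_or_ne (onesForm M) 0 with h | h
    · simp [ht, h]
    · rw [ht]; field_simp
  rw [h1]
  have h5 : (u - (c * t * g) • (1 : Ix nu ns → ℝ)) ⬝ᵥ M *ᵥ (u - (c * t * g) • 1)
      = u ⬝ᵥ M *ᵥ u - 2 * c * t * g ^ 2 + c ^ 2 * (t ^ 2 * onesForm M) * g ^ 2 := by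
    simp only [mulVec_sub, mulVec_smul, dotProduct_sub, sub_dotProduct, smul_dotProduct,
      dotProduct_smul, smul_eq_mul, hg', ← hg, onesForm]
    ring
  rw [h5, htt]
  simp only [star_trivial, sub_mulVec, add_mulVec, smul_mulVec, dotProduct_add, dotProduct_sub,
    dotProduct_smul, smul_eq_mul, h3, h4] at h2
  have h6 : 0 ≤ t * g ^ 2 := by positivity
  nlinarith [mul_nonneg (sub_nonneg.2 hc) h6]

/-- The scaling `2/(μ₂ + μm)` centres the spectrum: the factor lies within `±(μm - μ₂)/(μm + μ₂)`, a
radius that `h` bounds by `ζ`. -/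
theorem consensus_factor_bound {μ₂ μm μj ζ : ℝ} (h2 : 0 < μ₂) (h2j : μ₂ ≤ μj) (hjm : μj ≤ μm)
    (hζ : 0 < ζ) (h : ζ⁻¹ * (1 - μ₂ / μm) ≤ 1 + μ₂ / μm) :
    (1 - μj * (2 / (μ₂ + μm))) ^ 2 ≤ ζ ^ 2 := by
  have hm : 0 < μm := by linarith
  have h' : μm - μ₂ ≤ ζ * (μm + μ₂) := by
    have := mul_le_mul_of_nonneg_left h (mul_pos hζ hm).le
    field_simp at this
    linarith
  have hs : 0 < μ₂ + μm := by linarith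
  rw [sq_le_sq, abs_of_pos hζ, abs_le]
  have he : 1 - μj * (2 / (μ₂ + μm)) = (μ₂ + μm - 2 * μj) / (μ₂ + μm) := by field_simp
  rw [he, le_div_iff₀ hs, div_le_iff₀ hs]
  constructor <;> nlinarith

end ConsensusGain

/-! ### Cross-covariances -/

section CrossCov

variable {Ω ι κ ι' κ' : Type*} [MeasurableSpace Ω]

/-- Cross-covariance matrix of two random vectors. -/
noncomputable def crossCov (Pr : Measure Ω) (X : Ω → ι → ℝ) (Y : Ω → κ → ℝ) : Matrix ι κ ℝ :=
  Matrix.of fun a b => cov[fun ω => X ω a, fun ω => Y ω b; Pr]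

/-- All coordinates of a random vector are square integrable. -/
def IsL2 (Pr : Measure Ω) (X : Ω → ι → ℝ) : Prop := ∀ a, MemLp (fun ω => X ω a) 2 Pr

variable {Pr : Measure Ω}

theorem crossCov_self (X : Ω → ι → ℝ) : crossCov Pr X X = covMat Pr X := rfl

theorem crossCov_transpose (X : Ω → ι → ℝ) (Y : Ω → κ → ℝ) :
    (crossCov Pr X Y)ᵀ = crossCov Pr Y X := by
  ext a b
  exact covariance_comm _ _

theorem IsL2.add {X Y : Ω → ι → ℝ} (hX : IsL2 Pr X) (hY : IsL2 Pr Y) :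
    IsL2 Pr fun ω => X ω + Y ω := fun a => (hX a).add (hY a)

theorem IsL2.mulVec [Fintype ι] {X : Ω → ι → ℝ} (hX : IsL2 Pr X) (M : Matrix ι' ι ℝ) :
    IsL2 Pr fun ω => M *ᵥ X ω := fun a => by
  simp only [Matrix.mulVec, dotProduct]
  exact memLp_finsetSum _ fun i _ => (hX i).const_mul _

section

variable [IsFiniteMeasure Pr]

theorem crossCov_add_left {X X' : Ω → ι → ℝ} {Y : Ω → κ → ℝ} (hX : IsL2 Pr X) (hX' : IsL2 Pr X')
    (hY : IsL2 Pr Y) :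
    crossCov Pr (fun ω => X ω + X' ω) Y = crossCov Pr X Y + crossCov Pr X' Y := by
  ext a b
  exact covariance_add_left (hX a) (hX' a) (hY b)

theorem crossCov_add_right {X : Ω → ι → ℝ} {Y Y' : Ω → κ → ℝ} (hX : IsL2 Pr X) (hY : IsL2 Pr Y)
    (hY' : IsL2 Pr Y') :
    crossCov Pr X (fun ω => Y ω + Y' ω) = crossCov Pr X Y + crossCov Pr X Y' := by
  ext a b
  exact covariance_add_right (hX a) (hY b) (hY' b)

theorem crossCov_mulVec_left [Fintype ι] {X : Ω → ι → ℝ} {Y : Ω → κ → ℝ} (hX : IsL2 Pr X)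
    (hY : IsL2 Pr Y) (M : Matrix ι' ι ℝ) :
    crossCov Pr (fun ω => M *ᵥ X ω) Y = M * crossCov Pr X Y := by
  ext a b
  simp only [crossCov, of_apply, Matrix.mulVec, dotProduct, Matrix.mul_apply]
  rw [covariance_fun_sum_left (fun i => (hX i).const_mul _) (hY b)]
  simp only [covariance_const_mul_left]

theorem crossCov_mulVec_right [Fintype κ] {X : Ω → ι → ℝ} {Y : Ω → κ → ℝ} (hX : IsL2 Pr X)
    (hY : IsL2 Pr Y) (M : Matrix κ' κ ℝ) :
    crossCov Pr X (fun ω => M *ᵥ Y ω) = crossCov Pr X Y * Mᵀ := by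
  rw [← crossCov_transpose, crossCov_mulVec_left hY hX, transpose_mul, crossCov_transpose]

theorem crossCov_linear_right {κ₁ κ₂ κ₃ : Type*} [Fintype κ₁] [Fintype κ₂] [Fintype κ₃]
    {X : Ω → ι → ℝ} {Y₁ : Ω → κ₁ → ℝ} {Y₂ : Ω → κ₂ → ℝ} {Y₃ : Ω → κ₃ → ℝ} (hX : IsL2 Pr X)
    (h₁ : IsL2 Pr Y₁) (h₂ : IsL2 Pr Y₂) (h₃ : IsL2 Pr Y₃) (M₁ : Matrix κ κ₁ ℝ)
    (M₂ : Matrix κ κ₂ ℝ) (M₃ : Matrix κ κ₃ ℝ) :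
    crossCov Pr X (fun ω => M₁ *ᵥ Y₁ ω + M₂ *ᵥ Y₂ ω + M₃ *ᵥ Y₃ ω)
      = crossCov Pr X Y₁ * M₁ᵀ + crossCov Pr X Y₂ * M₂ᵀ + crossCov Pr X Y₃ * M₃ᵀ := by
  rw [crossCov_add_right hX ((h₁.mulVec _).add (h₂.mulVec _)) (h₃.mulVec _),
    crossCov_add_right hX (h₁.mulVec _) (h₂.mulVec _), crossCov_mulVec_right hX h₁,
    crossCov_mulVec_right hX h₂, crossCov_mulVec_right hX h₃]

theorem covMat_mulVec [Fintype ι] {X : Ω → ι → ℝ} (hX : IsL2 Pr X) (M : Matrix ι' ι ℝ) :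
    covMat Pr (fun ω => M *ᵥ X ω) = M * covMat Pr X * Mᵀ := by
  rw [← crossCov_self, crossCov_mulVec_left hX (hX.mulVec M), crossCov_mulVec_right hX hX,
    Matrix.mul_assoc]
  rfl

end

theorem crossCov_eq_zero_of_indepFun [IsProbabilityMeasure Pr] {X : Ω → ι → ℝ} {Y : Ω → κ → ℝ}
    (hX : IsL2 Pr X) (hY : IsL2 Pr Y) (h : IndepFun X Y Pr) : crossCov Pr X Y = 0 := by
  ext a b
  exact (h.comp (measurable_pi_apply a) (measurable_pi_apply b)).covariance_eq_zero (hX a) (hY b)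

theorem isL2_of_hasLaw [Fintype ι] [DecidableEq ι] {X : Ω → ι → ℝ} {V : Matrix ι ι ℝ}
    (h : HasLaw (fun ω => WithLp.toLp 2 (X ω)) (multivariateGaussian 0 V) Pr) : IsL2 Pr X :=
  fun a => (h.hasGaussianLaw.map_fun (EuclideanSpace.proj (𝕜 := ℝ) a)).memLp_two

theorem covMat_of_hasLaw [Fintype ι] [DecidableEq ι] {X : Ω → ι → ℝ} {V : Matrix ι ι ℝ}
    (hV : V.PosSemidef)
    (h : HasLaw (fun ω => WithLp.toLp 2 (X ω)) (multivariateGaussian 0 V) Pr) :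
    covMat Pr X = V := by
  ext a b
  rw [← covariance_eval_multivariateGaussian (μ := 0) hV a b]
  exact h.covariance_fun_comp (f := fun x => x a) (g := fun x => x b)
    (Measurable.aemeasurable (by fun_prop)) (Measurable.aemeasurable (by fun_prop))

end CrossCov

/-! ### Random vectors determined by the past -/

section Past

variable {nu ns m : ℕ} {p : Plant nu ns m} {Ω ι κ ι' : Type*} [MeasurableSpace Ω] {Pr : Measure Ω}
  {x0 : Ω → Ix nu ns → ℝ} {w : ℕ → Ω → Ix nu ns → ℝ} {v : ℕ → Ω → Fin m → ℝ}

/-- `X` is square integrable and uncorrelated with the noises that act after time `k`. -/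
structure IsPast (Pr : Measure Ω) (w : ℕ → Ω → Ix nu ns → ℝ) (v : ℕ → Ω → Fin m → ℝ) (k : ℕ)
    (X : Ω → ι → ℝ) : Prop where
  isL2 : IsL2 Pr X
  cov_w : ∀ j, k ≤ j → crossCov Pr X (w j) = 0
  cov_v : ∀ j, k < j → crossCov Pr X (v j) = 0

theorem IsPast.mono {k l : ℕ} (hkl : k ≤ l) {X : Ω → ι → ℝ} (h : IsPast Pr w v k X) :
    IsPast Pr w v l X :=
  ⟨h.isL2, fun j hj => h.cov_w j (hkl.trans hj), fun j hj => h.cov_v j (hkl.trans_lt hj)⟩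

variable [IsProbabilityMeasure Pr]

namespace IsPast

theorem add (hn : p.IsNoise Pr x0 w v) {k : ℕ} {X Y : Ω → ι → ℝ} (hX : IsPast Pr w v k X)
    (hY : IsPast Pr w v k Y) : IsPast Pr w v k fun ω => X ω + Y ω where
  isL2 := hX.isL2.add hY.isL2
  cov_w j hj := by
    rw [crossCov_add_left hX.isL2 hY.isL2 (isL2_of_hasLaw (hn.law_w j)), hX.cov_w j hj,
      hY.cov_w j hj, add_zero]
  cov_v j hj := by
    rw [crossCov_add_left hX.isL2 hY.isL2 (isL2_of_hasLaw (hn.law_v j)), hX.cov_v j hj,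
      hY.cov_v j hj, add_zero]

theorem mulVec [Fintype ι] (hn : p.IsNoise Pr x0 w v) {k : ℕ} {X : Ω → ι → ℝ}
    (hX : IsPast Pr w v k X) (M : Matrix ι' ι ℝ) : IsPast Pr w v k fun ω => M *ᵥ X ω where
  isL2 := hX.isL2.mulVec M
  cov_w j hj := by
    rw [crossCov_mulVec_left hX.isL2 (isL2_of_hasLaw (hn.law_w j)), hX.cov_w j hj,
      Matrix.mul_zero]
  cov_v j hj := by
    rw [crossCov_mulVec_left hX.isL2 (isL2_of_hasLaw (hn.law_v j)), hX.cov_v j hj,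
      Matrix.mul_zero]

end IsPast

namespace Plant.IsNoise

theorem crossCov_v_w (hn : p.IsNoise Pr x0 w v) (i j : ℕ) : crossCov Pr (v i) (w j) = 0 :=
  crossCov_eq_zero_of_indepFun (isL2_of_hasLaw (hn.law_v i)) (isL2_of_hasLaw (hn.law_w j))
    (hn.indep_v_all.comp (φ := fun f : ℕ → Fin m → ℝ => f i)
      (ψ := fun g : (Ix nu ns → ℝ) × (ℕ → Ix nu ns → ℝ) => g.2 j) (by fun_prop) (by fun_prop))

theorem crossCov_w_v (hn : p.IsNoise Pr x0 w v) (i j : ℕ) : crossCov Pr (w i) (v j) = 0 := by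
  rw [← crossCov_transpose, hn.crossCov_v_w, transpose_zero]

theorem isPast_x0 (hn : p.IsNoise Pr x0 w v) : IsPast Pr w v 0 x0 where
  isL2 := isL2_of_hasLaw hn.law_x0
  cov_w j _ := crossCov_eq_zero_of_indepFun (isL2_of_hasLaw hn.law_x0)
    (isL2_of_hasLaw (hn.law_w j))
    (hn.indep_x0_w.comp (φ := id) (ψ := fun g : ℕ → Ix nu ns → ℝ => g j) measurable_id
      (by fun_prop))
  cov_v j _ := crossCov_eq_zero_of_indepFun (isL2_of_hasLaw hn.law_x0)
    (isL2_of_hasLaw (hn.law_v j))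
    (hn.indep_v_all.comp (φ := fun f : ℕ → Fin m → ℝ => f j)
      (ψ := fun g : (Ix nu ns → ℝ) × (ℕ → Ix nu ns → ℝ) => g.1) (by fun_prop) (by fun_prop)).symm

/-- `w k` first acts in the transition to time `k + 1`, whereas `v k` already enters the measurement
at time `k`; hence the different time indices for the two noises. -/
theorem isPast_w (hn : p.IsNoise Pr x0 w v) (k : ℕ) : IsPast Pr w v (k + 1) (w k) where
  isL2 := isL2_of_hasLaw (hn.law_w k)
  cov_w j hj := crossCov_eq_zero_of_indepFun (isL2_of_hasLaw (hn.law_w k))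
    (isL2_of_hasLaw (hn.law_w j)) (hn.indep_w.indepFun (by omega))
  cov_v j _ := hn.crossCov_w_v k j

theorem isPast_v (hn : p.IsNoise Pr x0 w v) (k : ℕ) : IsPast Pr w v k (v k) where
  isL2 := isL2_of_hasLaw (hn.law_v k)
  cov_w j _ := hn.crossCov_v_w k j
  cov_v j hj := crossCov_eq_zero_of_indepFun (isL2_of_hasLaw (hn.law_v k))
    (isL2_of_hasLaw (hn.law_v j)) (hn.indep_v.indepFun (by omega))

end Plant.IsNoise

theorem IsPast.step [Fintype ι] (hn : p.IsNoise Pr x0 w v) {k : ℕ} {X : Ω → ι → ℝ}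
    (hX : IsPast Pr w v k X) (F : Matrix ι' ι ℝ) (B : Matrix ι' (Ix nu ns) ℝ)
    (D : Matrix ι' (Fin m) ℝ) :
    IsPast Pr w v (k + 1) fun ω => F *ᵥ X ω + B *ᵥ w k ω + D *ᵥ v (k + 1) ω :=
  (((hX.mono k.le_succ).mulVec hn F).add hn ((hn.isPast_w k).mulVec hn B)).add hn
    ((hn.isPast_v (k + 1)).mulVec hn D)

/-- Propagation of cross-covariances through one step of two linear systems. -/
theorem crossCov_step [Fintype ι] [Fintype κ] {κ' : Type*} (hp : p.Valid)
    (hn : p.IsNoise Pr x0 w v) {k : ℕ} {X : Ω → ι → ℝ} {Y : Ω → κ → ℝ} (hX : IsPast Pr w v k X)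
    (hY : IsPast Pr w v k Y) (F : Matrix ι' ι ℝ) (B : Matrix ι' (Ix nu ns) ℝ)
    (D : Matrix ι' (Fin m) ℝ) (F' : Matrix κ' κ ℝ) (B' : Matrix κ' (Ix nu ns) ℝ)
    (D' : Matrix κ' (Fin m) ℝ) :
    crossCov Pr (fun ω => F *ᵥ X ω + B *ᵥ w k ω + D *ᵥ v (k + 1) ω)
      (fun ω => F' *ᵥ Y ω + B' *ᵥ w k ω + D' *ᵥ v (k + 1) ω)
      = F * crossCov Pr X Y * F'ᵀ + B * p.Q * B'ᵀ + D * p.R * D'ᵀ := by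
  have hw := isL2_of_hasLaw (hn.law_w k)
  have hv := isL2_of_hasLaw (hn.law_v (k + 1))
  have hx := hX.isL2
  have hy := hY.isL2
  have hwy : crossCov Pr (w k) Y = 0 := by
    rw [← crossCov_transpose, hY.cov_w k le_rfl, transpose_zero]
  have hvy : crossCov Pr (v (k + 1)) Y = 0 := by
    rw [← crossCov_transpose, hY.cov_v _ k.lt_succ_self, transpose_zero]
  have hww : crossCov Pr (w k) (w k) = p.Q := covMat_of_hasLaw hp.Q_psd (hn.law_w k)
  have hvv : crossCov Pr (v (k + 1)) (v (k + 1)) = p.R :=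
    covMat_of_hasLaw hp.R_psd (hn.law_v (k + 1))
  have hY2 : IsL2 Pr fun ω => F' *ᵥ Y ω + B' *ᵥ w k ω := (hy.mulVec _).add (hw.mulVec _)
  have hY3 : IsL2 Pr fun ω => F' *ᵥ Y ω + B' *ᵥ w k ω + D' *ᵥ v (k + 1) ω := hY2.add (hv.mulVec _)
  rw [crossCov_add_left ((hx.mulVec _).add (hw.mulVec _)) (hv.mulVec _) hY3,
    crossCov_add_left (hx.mulVec _) (hw.mulVec _) hY3,
    crossCov_mulVec_left hx hY3, crossCov_mulVec_left hw hY3, crossCov_mulVec_left hv hY3]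
  rw [crossCov_linear_right hx hy hw hv, crossCov_linear_right hw hy hw hv,
    crossCov_linear_right hv hy hw hv, hX.cov_w k le_rfl, hX.cov_v _ k.lt_succ_self, hwy, hvy, hww,
    hvv,
    hn.crossCov_w_v, hn.crossCov_v_w]
  simp only [Matrix.zero_mul, add_zero, zero_add, Matrix.mul_assoc]

end Past

/-! ### Dynamics of the stacked local filters -/

section Stacked

variable {nu ns m : ℕ}

theorem kronecker_mulVec_apply {ι ι' κ κ' : Type*} [Fintype ι'] [Fintype κ'] (A : Matrix ι ι' ℝ)
    (B : Matrix κ κ' ℝ) (x : ι' × κ' → ℝ) (i : ι) (j : κ) :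
    ((A ⊗ₖ B) *ᵥ x) (i, j) = (A *ᵥ fun i' => (B *ᵥ fun j' => x (i', j')) j) i := by
  simp only [Matrix.mulVec, dotProduct, kroneckerMap_apply, Fintype.sum_prod_type, Finset.mul_sum,
    mul_assoc]

theorem one_kronecker_mulVec_apply {ι κ κ' : Type*} [Fintype ι] [DecidableEq ι] [Fintype κ']
    (B : Matrix κ κ' ℝ) (x : ι × κ' → ℝ) (i : ι) (j : κ) :
    (((1 : Matrix ι ι ℝ) ⊗ₖ B) *ᵥ x) (i, j) = (B *ᵥ fun j' => x (i, j')) j := by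
  rw [kronecker_mulVec_apply, one_mulVec]

theorem Btil_mulVec_apply (z : Fin m → ℝ) (j : Fin m) (b : Ix nu ns) :
    (Btil nu ns m *ᵥ z) (j, b) = z j := by
  simp [Btil, Matrix.mulVec, dotProduct]

theorem Gtil_mulVec_apply (Γ : Ix nu ns → ℝ) (x : Fin m × Ix nu ns → ℝ) (j : Fin m) :
    (Gtil m Γ *ᵥ x) j = Γ ⬝ᵥ fun b => x (j, b) := by
  simp [Gtil, Matrix.mulVec, dotProduct, Fintype.sum_prod_type]

theorem Leta_mulVec_apply (z : Fin m → ℝ) (i : Fin m) (jb : Fin m × Ix nu ns) :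
    (Leta nu ns m *ᵥ z) (i, jb) = z i * Btil nu ns m jb i := by
  simp [Leta, Matrix.mulVec, dotProduct, mul_comm]

variable (a : Matrix (Fin m) (Fin m) ℝ) (f : LocalFilter nu ns m) (Γ : Ix nu ns → ℝ)
  (y : ℕ → Fin m → ℝ)

/-- The local filter states of all sensors, stacked. -/
def xiVec (k : ℕ) : Fin m × Ix nu ns → ℝ := fun ib => f.xi y k ib.1 ib.2

/-- The consensus states of all sensors, stacked. -/
def etaVec (k : ℕ) : Fin m × (Fin m × Ix nu ns) → ℝ := fun ijb => eta a f Γ y k ijb.1 ijb.2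

theorem xiVec_zero : xiVec f y 0 = 0 := rfl

theorem etaVec_zero : etaVec a f Γ y 0 = 0 := rfl

theorem resid_eq (k : ℕ) : f.resid y k = y (k + 1) - Gtil m f.β *ᵥ xiVec f y k := by
  ext i
  rw [Pi.sub_apply, Gtil_mulVec_apply]
  rfl

theorem xiVec_succ_eq_S (k : ℕ) :
    xiVec f y (k + 1) = Stil m f.S *ᵥ xiVec f y k + Btil nu ns m *ᵥ f.resid y k := by
  ext ⟨i, b⟩
  rw [Pi.add_apply, Stil, one_kronecker_mulVec_apply, Btil_mulVec_apply]
  simp [xiVec, LocalFilter.xi, LocalFilter.resid]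

/-- The `βᵀ ξ` inside `S` cancels the one subtracted in the residual, exposing the stable matrix
`Λ`. -/
theorem xiVec_succ (k : ℕ) :
    xiVec f y (k + 1) = Stil m f.Lam *ᵥ xiVec f y k + Btil nu ns m *ᵥ y (k + 1) := by
  ext ⟨i, b⟩
  rw [Pi.add_apply, Stil, one_kronecker_mulVec_apply, Btil_mulVec_apply]
  simp only [xiVec, LocalFilter.xi, LocalFilter.S, add_mulVec, vecMulVec_mulVec, Pi.add_apply,
    op_smul_eq_smul, Pi.smul_apply, Pi.one_apply, smul_eq_mul, mul_one]
  ring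

theorem etaVec_succ (k : ℕ) :
    etaVec a f Γ y (k + 1)
      = ((1 : Matrix (Fin m) (Fin m) ℝ) ⊗ₖ Stil m f.S
          - laplacian a ⊗ₖ (Btil nu ns m * Gtil m Γ)) *ᵥ etaVec a f Γ y k
        + Leta nu ns m *ᵥ f.resid y k := by
  ext ⟨i, j, b⟩
  rw [Pi.add_apply, sub_mulVec, Pi.sub_apply, one_kronecker_mulVec_apply, kronecker_mulVec_apply,
    laplacian_mulVec_apply, Leta_mulVec_apply]
  simp only [← mulVec_mulVec, Btil_mulVec_apply]
  simp only [etaVec, eta, Pi.add_apply, Pi.smul_apply, smul_eq_mul, Btil_mulVec_apply,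
    Finset.sum_apply, Pi.sub_apply]
  have : ∀ l, a i l * ((Gtil m Γ *ᵥ eta a f Γ y k l) j - (Gtil m Γ *ᵥ eta a f Γ y k i) j)
      = -(a i l * ((Gtil m Γ *ᵥ eta a f Γ y k i) j - (Gtil m Γ *ᵥ eta a f Γ y k l) j)) :=
    fun l => by ring
  simp only [this, Finset.sum_neg_distrib]
  ring

/-- Symmetric weights cancel the coupling in the sum, leaving the recursion of `ξ` from the same
zero start. -/
theorem sum_eta (ha : IsNetwork a) (k : ℕ) : ∑ i, eta a f Γ y k i = xiVec f y k := by
  induction k with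
  | zero => simp [eta, xiVec_zero]
  | succ k ih =>
    rw [xiVec_succ_eq_S, ← ih]
    simp only [eta, Finset.sum_add_distrib, ← mulVec_sum]
    have hzero : ∑ i, ∑ j, a i j • (Gtil m Γ *ᵥ eta a f Γ y k j - Gtil m Γ *ᵥ eta a f Γ y k i)
        = 0 := by
      simp only [smul_sub, Finset.sum_sub_distrib]
      rw [sub_eq_zero, Finset.sum_comm]
      exact Finset.sum_congr rfl fun i _ => Finset.sum_congr rfl fun j _ => by rw [ha.symm]
    rw [hzero, mulVec_zero, add_zero]
    congr 1
    ext jb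
    simp [Matrix.mulVec, dotProduct, mul_comm]

variable {f} in
theorem bigF_mul_Stil {p : Plant nu ns m} {K : Matrix (Ix nu ns) (Fin m) ℝ}
    (hf : f.IsDecomposition p K) : f.bigF * Stil m f.Lam = (p.A - K * p.C * p.A) * f.bigF := by
  ext s ⟨j, b⟩
  have := congrFun (congrFun (hf.F_comm j) s) b
  rw [Matrix.mul_apply] at this ⊢
  simpa [Stil, LocalFilter.bigF, Fintype.sum_prod_type, Matrix.one_apply, Matrix.mul_apply]
    using this

variable {f} in
theorem bigF_mul_Btil {p : Plant nu ns m} {K : Matrix (Ix nu ns) (Fin m) ℝ}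
    (hf : f.IsDecomposition p K) : f.bigF * Btil nu ns m = K := by
  ext s j
  have := congrFun (hf.F_one j) s
  simpa [Btil, LocalFilter.bigF, Fintype.sum_prod_type, Matrix.mul_apply, Matrix.mulVec, dotProduct,
    Finset.sum_comm] using this

variable {f} in
/-- The Kalman estimate is a linear fusion of the local filter states. -/
theorem estimate_eq_bigF_mulVec {p : Plant nu ns m} {K : Matrix (Ix nu ns) (Fin m) ℝ}
    (hf : f.IsDecomposition p K) (k : ℕ) : p.estimate K y k = f.bigF *ᵥ xiVec f y k := by
  induction k with
  | zero => simp [Plant.estimate, xiVec_zero]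
  | succ k ih =>
    rw [xiVec_succ, mulVec_add, mulVec_mulVec, mulVec_mulVec, bigF_mul_Stil hf, bigF_mul_Btil hf,
      ← mulVec_mulVec, ← ih, Plant.estimate]
    simp only [sub_mulVec, mulVec_sub, mulVec_mulVec, Matrix.mul_assoc]
    abel

end Stacked

/-! ### The reduced error dynamics -/

section Reduced

variable {nu ns m : ℕ} {p : Plant nu ns m} {f : LocalFilter nu ns m}
  {a : Matrix (Fin m) (Fin m) ℝ} {μ : Fin m → ℝ} {Φ : Matrix (Fin m) (Fin m) ℝ}

/-- `col(G_i)` with `G_i = [Gᵘ_i 0]`. -/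
def colG (G : Fin m → Matrix (Ix nu ns) (Fin nu) ℝ) : Matrix (Fin m × Ix nu ns) (Ix nu ns) ℝ :=
  Matrix.of fun ib s => fromCols (G ib.1) (0 : Matrix (Ix nu ns) (Fin ns) ℝ) ib.2 s

/-- `J = [0 I]`. -/
def stableProj (nu ns : ℕ) : Matrix (Fin ns) (Ix nu ns) ℝ := fromCols 0 1

theorem stableProj_mul_A : stableProj nu ns * p.A = p.As * stableProj nu ns := by
  rw [stableProj, Plant.A, fromCols_mul_fromBlocks, mul_fromCols]
  simp

/-- `[Cᵘ Aᵘ 0]`. -/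
def unstableOut (p : Plant nu ns m) : Matrix (Fin m) (Ix nu ns) ℝ :=
  fromCols (p.C.toCols₁ * p.Au) 0

theorem C_mul_A : p.C * p.A = unstableOut p + p.C.toCols₂ * p.As * stableProj nu ns := by
  nth_rewrite 1 [← fromCols_toCols p.C]
  rw [stableProj, Plant.A, unstableOut, fromCols_mul_fromBlocks, mul_fromCols]
  ext i (s | s) <;> simp

theorem Gtil_mul_colG {G : Fin m → Matrix (Ix nu ns) (Fin nu) ℝ}
    (hG : ∀ i, f.S * G i = G i * p.Au ∧ f.β ᵥ* G i = p.C.toCols₁ i ᵥ* p.Au) :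
    Gtil m f.β * colG G = unstableOut p := by
  ext i (s | s)
  · have h := congrFun (hG i).2 s
    simpa [Gtil, colG, unstableOut, Matrix.mul_apply, Fintype.sum_prod_type, Matrix.vecMul,
      dotProduct] using h
  · simp [Gtil, colG, unstableOut, Matrix.mul_apply]

/-- Expanding `S = Λ + 1βᵀ` in `S G_i = G_i Aᵘ` gives the form needed for `ε = G x - ξ` to propagate
by `Λ` with no forcing from `xᵘ`. -/
theorem colG_mul_A {G : Fin m → Matrix (Ix nu ns) (Fin nu) ℝ}
    (hG : ∀ i, f.S * G i = G i * p.Au ∧ f.β ᵥ* G i = p.C.toCols₁ i ᵥ* p.Au) :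
    colG G * p.A = Stil m f.Lam * colG G + Btil nu ns m * unstableOut p := by
  ext ⟨i, b⟩ (s | s)
  · have h := congrFun (congrFun (hG i).1 b) s
    rw [LocalFilter.S, Matrix.add_mul, vecMulVec_mul, (hG i).2] at h
    simpa [Stil, Btil, colG, unstableOut, Plant.A, Matrix.mul_apply, Fintype.sum_prod_type,
      Matrix.one_apply, Matrix.vecMul, dotProduct] using h.symm
  · simp [Stil, Btil, colG, unstableOut, Plant.A, Matrix.mul_apply]

/-- The centring projection is redundant: the tail columns of `Φ` already sum to zero. -/
theorem Ldelta_eq (hΦ : IsLapDiag a μ Φ) :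
    Ldelta nu ns Φ = ((tailCols Φ)ᵀ ⊗ₖ
      (1 : Matrix (Fin m × Ix nu ns) (Fin m × Ix nu ns) ℝ)) * Leta nu ns m := by
  rw [Ldelta, Matrix.mul_sub, Matrix.mul_one, Matrix.mul_smul, hΦ.tailCols_transpose_mul_one,
    smul_zero, sub_zero]

theorem tailCols_kronecker_mul (hΦ : IsLapDiag a μ Φ) (S : Matrix (Ix nu ns) (Ix nu ns) ℝ)
    (Γ : Ix nu ns → ℝ) :
    ((tailCols Φ)ᵀ ⊗ₖ (1 : Matrix (Fin m × Ix nu ns) (Fin m × Ix nu ns) ℝ))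
        * ((1 : Matrix (Fin m) (Fin m) ℝ) ⊗ₖ Stil m S
          - laplacian a ⊗ₖ (Btil nu ns m * Gtil m Γ))
      = Adelta μ S Γ
        * ((tailCols Φ)ᵀ ⊗ₖ (1 : Matrix (Fin m × Ix nu ns) (Fin m × Ix nu ns) ℝ)) := by
  rw [Adelta, Matrix.mul_sub, Matrix.sub_mul, ← mul_kronecker_mul, ← mul_kronecker_mul,
    ← mul_kronecker_mul, ← mul_kronecker_mul, hΦ.tailCols_transpose_mul_laplacian]
  simp only [Matrix.mul_one, Matrix.one_mul]

/-- The state `(δ̃₂, ε, xˢ)` of the reduced error dynamics. -/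
noncomputable def redState (p : Plant nu ns m) (f : LocalFilter nu ns m)
    (a : Matrix (Fin m) (Fin m) ℝ) (Γ : Ix nu ns → ℝ) (Φ : Matrix (Fin m) (Fin m) ℝ)
    (G : Fin m → Matrix (Ix nu ns) (Fin nu) ℝ) (x0 : Ix nu ns → ℝ) (w : ℕ → Ix nu ns → ℝ)
    (v : ℕ → Fin m → ℝ) (k : ℕ) : RIx nu ns m → ℝ :=
  Sum.elim
    (((tailCols Φ)ᵀ ⊗ₖ (1 : Matrix (Fin m × Ix nu ns) (Fin m × Ix nu ns) ℝ)) *ᵥ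
      etaVec a f Γ (p.meas x0 w v) k)
    (Sum.elim (colG G *ᵥ p.state x0 w k - xiVec f (p.meas x0 w v) k)
      (stableProj nu ns *ᵥ p.state x0 w k))

theorem redState_zero (Γ : Ix nu ns → ℝ) (G : Fin m → Matrix (Ix nu ns) (Fin nu) ℝ)
    (x0 : Ix nu ns → ℝ) (w : ℕ → Ix nu ns → ℝ) (v : ℕ → Fin m → ℝ) :
    redState p f a Γ Φ G x0 w v 0
      = fromRows (0 : Matrix (Tail m × (Fin m × Ix nu ns)) (Ix nu ns) ℝ)
          (fromRows (colG G) (stableProj nu ns)) *ᵥ x0 := by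
  rw [fromRows_mulVec, fromRows_mulVec, redState, etaVec_zero, xiVec_zero, mulVec_zero, sub_zero,
    zero_mulVec]
  rfl

/-- `βᵀ G_i = Cᵘ_i Aᵘ` cancels the possibly growing unstable state, so the consensus is driven by
stable signals and noise only. -/
theorem resid_meas_eq {G : Fin m → Matrix (Ix nu ns) (Fin nu) ℝ}
    (hG : ∀ i, f.S * G i = G i * p.Au ∧ f.β ᵥ* G i = p.C.toCols₁ i ᵥ* p.Au)
    (x0 : Ix nu ns → ℝ) (w : ℕ → Ix nu ns → ℝ) (v : ℕ → Fin m → ℝ) (k : ℕ) :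
    f.resid (p.meas x0 w v) k
      = Gtil m f.β *ᵥ (colG G *ᵥ p.state x0 w k - xiVec f (p.meas x0 w v) k)
        + (p.C.toCols₂ * p.As) *ᵥ (stableProj nu ns *ᵥ p.state x0 w k)
        + p.C *ᵥ w k + v (k + 1) := by
  rw [resid_eq, mulVec_sub, mulVec_mulVec, Gtil_mul_colG hG, Plant.meas, Plant.state, mulVec_add,
    mulVec_mulVec, C_mul_A, add_mulVec, mulVec_mulVec]
  abel

theorem redState_succ (hΦ : IsLapDiag a μ Φ) (Γ : Ix nu ns → ℝ)
    {G : Fin m → Matrix (Ix nu ns) (Fin nu) ℝ}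
    (hG : ∀ i, f.S * G i = G i * p.Au ∧ f.β ᵥ* G i = p.C.toCols₁ i ᵥ* p.Au)
    (x0 : Ix nu ns → ℝ) (w : ℕ → Ix nu ns → ℝ) (v : ℕ → Fin m → ℝ) (k : ℕ) :
    redState p f a Γ Φ G x0 w v (k + 1)
      = Ar p f Γ μ Φ *ᵥ redState p f a Γ Φ G x0 w v k + Bw p Φ G *ᵥ w k
        + Bv nu ns Φ *ᵥ v (k + 1) := by
  have hBw : Bw p Φ G = fromRows (Ldelta nu ns Φ * p.C)
      (fromRows (colG G - Btil nu ns m * p.C) (stableProj nu ns)) := by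
    have h : (Matrix.of fun ib s => fromCols (G ib.1) (0 : Matrix (Ix nu ns) (Fin ns) ℝ) ib.2 s
        - p.C ib.1 s) = colG G - Btil nu ns m * p.C := by
      ext ⟨i, b⟩ s
      simp [colG, Btil, Matrix.mul_apply]
    rw [Bw, h]
    rfl
  rw [redState, redState, Ar, hBw, Bv, fromBlocks_mulVec, fromRows_mulVec, fromRows_mulVec,
    fromRows_mulVec, fromRows_mulVec]
  simp only [Sum.elim_comp_inl, Sum.elim_comp_inr, fromCols_mulVec, fromBlocks_mulVec, zero_mulVec,
    zero_add, add_zero, ← Sum.elim_add_add]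
  congr 1
  · rw [etaVec_succ, mulVec_add, mulVec_mulVec, tailCols_kronecker_mul hΦ, mulVec_mulVec,
      ← Ldelta_eq hΦ, resid_meas_eq hG]
    simp only [mulVec_add, ← mulVec_mulVec]
    abel
  congr 1
  · rw [xiVec_succ]
    simp only [Plant.meas, Plant.state, mulVec_add, mulVec_mulVec, C_mul_A, colG_mul_A hG,
      add_mulVec, sub_mulVec, mulVec_sub, Matrix.neg_mul, neg_mulVec, Matrix.mul_assoc]
    abel
  · rw [Plant.state, mulVec_add, mulVec_mulVec, stableProj_mul_A, ← mulVec_mulVec]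

/-- The gap between the fused estimates and the Kalman estimate is an output of the reduced error
dynamics. -/
theorem fused_sub_estimate_eq (hm : m ≠ 0) (ha : IsNetwork a) (hΦ : IsLapDiag a μ Φ)
    {K : Matrix (Ix nu ns) (Fin m) ℝ} (hf : f.IsDecomposition p K) (Γ : Ix nu ns → ℝ)
    (G : Fin m → Matrix (Ix nu ns) (Fin nu) ℝ)
    (x0 : Ix nu ns → ℝ) (w : ℕ → Ix nu ns → ℝ) (v : ℕ → Fin m → ℝ) (k : ℕ) :
    (fun is : Fin m × Ix nu ns => fused a f Γ (p.meas x0 w v) k is.1 is.2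
        - p.estimate K (p.meas x0 w v) k is.2)
      = outMat f Φ *ᵥ redState p f a Γ Φ G x0 w v k := by
  ext ⟨i, s⟩
  rw [outMat, ← mulVec_mulVec, redState, fromCols_mulVec]
  simp only [Sum.elim_comp_inl, zero_mulVec, add_zero]
  -- `Φ₂ Φ₂ᵀ = I - 11ᵀ/m` turns the modal coordinates back into `η_i` minus the average, and `mF` of
  -- the average is `F ξ = x̂`.
  rw [mulVec_mulVec (M := tailCols Φ ⊗ₖ _), ← mul_kronecker_mul, hΦ.tailCols_mul_transpose,
    Matrix.mul_one, one_kronecker_mulVec_apply, estimate_eq_bigF_mulVec _ hf, ← sum_eta a f Γ _ ha]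
  have : (fun j' => (((1 - (m : ℝ)⁻¹ • vecMulVec 1 1 : Matrix (Fin m) (Fin m) ℝ) ⊗ₖ
      (1 : Matrix (Fin m × Ix nu ns) (Fin m × Ix nu ns) ℝ)) *ᵥ etaVec a f Γ (p.meas x0 w v) k)
        (i, j'))
      = eta a f Γ (p.meas x0 w v) k i - (m : ℝ)⁻¹ • ∑ l, eta a f Γ (p.meas x0 w v) k l := by
    ext jb
    rw [kronecker_mulVec_apply, sub_mulVec, smul_mulVec, vecMulVec_mulVec]
    simp [etaVec, dotProduct]
  rw [this, mulVec_sub, mulVec_smul, smul_mulVec, smul_mulVec, smul_smul, mul_comm,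
    mul_inv_cancel₀ (by simpa using hm)]
  simp [fused]

end Reduced

/-! ### Stability of the reduced error dynamics -/

section Stability

variable {nu ns m : ℕ} {p : Plant nu ns m} {f : LocalFilter nu ns m}
  {μ : Fin m → ℝ} {Φ : Matrix (Fin m) (Fin m) ℝ}

theorem isSchur_Stil {S : Matrix (Ix nu ns) (Ix nu ns) ℝ} (hS : IsSchur S) :
    IsSchur (Stil m S) :=
  isSchur_of_fibrewise (A := fun _ => S)
    (fun j i j' i' => by simp [Stil, Matrix.one_apply]) fun _ => hS

theorem isSchur_Adelta {S : Matrix (Ix nu ns) (Ix nu ns) ℝ} {Γ : Ix nu ns → ℝ}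
    (h : ∀ j : Tail m, IsSchur (S - vecMulVec 1 (μ j • Γ))) : IsSchur (Adelta μ S Γ) := by
  refine isSchur_of_fibrewise (A := fun j => Stil m (S - vecMulVec 1 (μ j • Γ))) ?_
    fun j => isSchur_Stil (h j)
  rintro j ⟨l, i⟩ j' ⟨l', i'⟩
  have hBG : (Btil nu ns m * Gtil m Γ) (l, i) (l', i') = if l = l' then Γ i' else 0 := by
    simp [Btil, Gtil, Matrix.mul_apply]
  rw [Adelta, Matrix.sub_apply, kroneckerMap_apply, kroneckerMap_apply, hBG, Stil, Stil,
    kroneckerMap_apply, kroneckerMap_apply, Matrix.one_apply, Matrix.one_apply, diagonal_apply,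
    Matrix.sub_apply, vecMulVec_apply]
  by_cases hj : j = j' <;> by_cases hl : l = l' <;> simp [hj, hl]

/-- Block triangularity leaves the consensus modes, `Λ` and `Aˢ`. Mode `j` is the closed loop of
`isSchur_sub_consensus` with `c = 2μ_j/(μ₂ + μm)`. -/
theorem isSchur_Ar (hp : p.Valid) (hlam : IsSchur f.Lam) {μ₂ μm ζ : ℝ} (hμ₂ : 0 < μ₂)
    (hlo : ∀ j : Tail m, μ₂ ≤ μ j) (hhi : ∀ j : Tail m, μ j ≤ μm) (hζ : 0 < ζ)
    (hζ₂ : ζ⁻¹ * (1 - μ₂ / μm) ≤ 1 + μ₂ / μm)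
    {M : Matrix (Ix nu ns) (Ix nu ns) ℝ} (hM : M.PosDef) (hric : RiccatiIneq ζ M f.S) :
    IsSchur (Ar p f (consensusGain μ₂ μm M f.S) μ Φ) := by
  refine isSchur_fromBlocks_zero₂₁ _ (isSchur_Adelta fun j => ?_)
    (isSchur_fromBlocks_zero₂₁ _ (isSchur_Stil hlam) hp.stable)
  have := isSchur_sub_consensus hM hric (consensus_factor_bound hμ₂ (hlo j) (hhi j) hζ hζ₂)
  rwa [consensusGain, smul_smul, ← mul_assoc]

end Stability

/-! ### The steady-state Kalman filter -/

section Kalman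

variable {nu ns m : ℕ} {p : Plant nu ns m} {P : Matrix (Ix nu ns) (Ix nu ns) ℝ}

theorem continuousAt_matrix_mul {α ι κ ι' : Type*} [TopologicalSpace α] [Fintype κ]
    {F : α → Matrix ι κ ℝ} {G : α → Matrix κ ι' ℝ} {t : α} (hF : ContinuousAt F t)
    (hG : ContinuousAt G t) : ContinuousAt (fun t => F t * G t) t :=
  (continuous_fst.matrix_mul continuous_snd).continuousAt.comp
    (f := fun t => (F t, G t)) (hF.prodMk hG)

/-- Limit of the recursion. Continuity of the Riccati map is needed only at `P`, where the
innovation covariance is invertible. -/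
theorem Plant.riccati_fixed_point (hP : Tendsto p.kalmanCov atTop (𝓝 P))
    (hinv : IsUnit (p.innovCov P)) : P = p.predCov P - p.gain P * p.C * p.predCov P := by
  have hpred : Continuous p.predCov := by
    unfold Plant.predCov
    fun_prop
  have hinn : Continuous p.innovCov := by
    unfold Plant.innovCov
    fun_prop
  have hdet : (p.innovCov P).det ≠ 0 := ((Matrix.isUnit_iff_isUnit_det _).1 hinv).ne_zero
  have hi : ContinuousAt (fun X => (p.innovCov X)⁻¹) P := by
    refine ContinuousAt.comp (g := Inv.inv) (continuousAt_matrix_inv _ ?_) hinn.continuousAt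
    rw [show (Ring.inverse : ℝ → ℝ) = Inv.inv from Ring.inverse_eq_inv']
    exact continuousAt_inv₀ hdet
  have hgain : ContinuousAt p.gain P := by
    unfold Plant.gain
    exact continuousAt_matrix_mul (hpred.matrix_mul continuous_const).continuousAt hi
  have hric : ContinuousAt (fun X => p.predCov X - p.gain X * p.C * p.predCov X) P :=
    hpred.continuousAt.sub (continuousAt_matrix_mul
      (continuousAt_matrix_mul hgain continuousAt_const) hpred.continuousAt)
  exact tendsto_nhds_unique (hP.comp (tendsto_add_atTop_nat 1)) (hric.tendsto.comp hP)

variable {K : Matrix (Ix nu ns) (Fin m) ℝ}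

theorem Plant.gain_mul_innovCov (hinv : IsUnit (p.innovCov P)) :
    p.gain P * p.innovCov P = p.predCov P * p.Cᵀ := by
  rw [Plant.gain, Matrix.mul_assoc,
    Matrix.nonsing_inv_mul _ ((Matrix.isUnit_iff_isUnit_det _).1 hinv), Matrix.mul_one]

/-- The innovation is uncorrelated with the new estimation error. -/
theorem Plant.gain_orthogonality (hinv : IsUnit (p.innovCov P)) (hK : K = p.gain P) :
    (p.A - K * p.C * p.A) * P * (-(p.C * p.A))ᵀ + (K * p.C - 1) * p.Q * p.Cᵀ
      + K * p.R * (1 : Matrix (Fin m) (Fin m) ℝ)ᵀ = 0 := by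
  have h := p.gain_mul_innovCov hinv
  rw [← hK, Plant.innovCov, Plant.predCov] at h
  have h' := sub_eq_zero.2 h
  -- The left side expands to the defect `K * innovCov - predCov * Cᵀ` of the normal equation for
  -- the gain.
  rw [← h']
  simp only [transpose_neg, transpose_mul, transpose_one, Matrix.mul_one, Matrix.sub_mul,
    Matrix.mul_neg, Matrix.mul_add, Matrix.add_mul, Matrix.mul_assoc, Matrix.one_mul]
  abel

/-- The stationary error covariance, in Joseph form. -/
theorem Plant.joseph_form (hP : Tendsto p.kalmanCov atTop (𝓝 P)) (hinv : IsUnit (p.innovCov P))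
    (hK : K = p.gain P) :
    (p.A - K * p.C * p.A) * P * (p.A - K * p.C * p.A)ᵀ + (K * p.C - 1) * p.Q * (K * p.C - 1)ᵀ
      + K * p.R * Kᵀ = P := by
  have h := p.gain_mul_innovCov hinv
  have hfix := p.riccati_fixed_point hP hinv
  rw [← hK] at h hfix
  -- By the normal equation the quadratic term in `K` cancels one cross term of the Joseph form,
  -- leaving the Riccati right-hand side.
  have h1 : K * p.innovCov P * Kᵀ = p.predCov P * p.Cᵀ * Kᵀ := by rw [h]
  have h2 : (p.A - K * p.C * p.A) * P * (p.A - K * p.C * p.A)ᵀ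
      + (K * p.C - 1) * p.Q * (K * p.C - 1)ᵀ + K * p.R * Kᵀ
      = p.predCov P - K * p.C * p.predCov P
        + (K * p.innovCov P * Kᵀ - p.predCov P * p.Cᵀ * Kᵀ) := by
    simp only [Plant.innovCov, Plant.predCov, transpose_sub, transpose_mul, transpose_one,
      Matrix.mul_one, Matrix.sub_mul, Matrix.mul_sub, Matrix.mul_add, Matrix.add_mul,
      Matrix.mul_assoc, Matrix.one_mul]
    abel
  rw [h2, h1, sub_self, add_zero, ← hfix]

theorem Plant.error_succ (x0 : Ix nu ns → ℝ) (w : ℕ → Ix nu ns → ℝ) (v : ℕ → Fin m → ℝ) (k : ℕ) :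
    p.estimate K (p.meas x0 w v) (k + 1) - p.state x0 w (k + 1)
      = (p.A - K * p.C * p.A) *ᵥ (p.estimate K (p.meas x0 w v) k - p.state x0 w k)
        + (K * p.C - 1) *ᵥ w k + K *ᵥ v (k + 1) := by
  rw [Plant.estimate, Plant.meas, Plant.state]
  simp only [sub_mulVec, mulVec_sub, mulVec_add, mulVec_mulVec, Matrix.mul_assoc, one_mulVec]
  abel

/-- Prediction plus innovation, with the innovation written through the previous error so that it
fits the one-step covariance formula. -/
theorem Plant.meas_succ (x0 : Ix nu ns → ℝ) (w : ℕ → Ix nu ns → ℝ) (v : ℕ → Fin m → ℝ) (k : ℕ) :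
    p.meas x0 w v (k + 1)
      = (p.C * p.A) *ᵥ p.estimate K (p.meas x0 w v) k
        + ((-(p.C * p.A)) *ᵥ (p.estimate K (p.meas x0 w v) k - p.state x0 w k)
        + p.C *ᵥ w k + (1 : Matrix (Fin m) (Fin m) ℝ) *ᵥ v (k + 1)) := by
  rw [Plant.meas, Plant.state]
  simp only [neg_mulVec, mulVec_sub, mulVec_add, mulVec_mulVec, one_mulVec]
  abel

variable {Ω : Type*} {x0 : Ω → Ix nu ns → ℝ} {w : ℕ → Ω → Ix nu ns → ℝ} {v : ℕ → Ω → Fin m → ℝ}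

/-- The measurements along a sample path. -/
noncomputable def path (p : Plant nu ns m) (x0 : Ω → Ix nu ns → ℝ) (w : ℕ → Ω → Ix nu ns → ℝ)
    (v : ℕ → Ω → Fin m → ℝ) (ω : Ω) : ℕ → Fin m → ℝ :=
  p.meas (x0 ω) (fun t => w t ω) (fun t => v t ω)

/-- The error of the Kalman estimate. -/
noncomputable def kalmanError (p : Plant nu ns m) (K : Matrix (Ix nu ns) (Fin m) ℝ)
    (x0 : Ω → Ix nu ns → ℝ) (w : ℕ → Ω → Ix nu ns → ℝ) (v : ℕ → Ω → Fin m → ℝ) (k : ℕ) (ω : Ω) :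
    Ix nu ns → ℝ :=
  p.estimate K (path p x0 w v ω) k - p.state (x0 ω) (fun t => w t ω) k

theorem kalmanError_succ (k : ℕ) : kalmanError p K x0 w v (k + 1) = fun ω =>
    (p.A - K * p.C * p.A) *ᵥ kalmanError p K x0 w v k ω + (K * p.C - 1) *ᵥ w k ω
      + K *ᵥ v (k + 1) ω :=
  funext fun _ => p.error_succ _ _ _ k

theorem kalmanError_zero : kalmanError p K x0 w v 0 = fun ω => (-1 : Matrix _ _ ℝ) *ᵥ x0 ω := by
  ext ω s
  simp [kalmanError, Plant.estimate, Plant.state, neg_mulVec]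

variable [MeasurableSpace Ω] {Pr : Measure Ω} [IsProbabilityMeasure Pr]

theorem isPast_kalmanError (hn : p.IsNoise Pr x0 w v) (k : ℕ) :
    IsPast Pr w v k (kalmanError p K x0 w v k) := by
  induction k with
  | zero => rw [kalmanError_zero]; exact hn.isPast_x0.mulVec hn _
  | succ k ih => rw [kalmanError_succ]; exact ih.step hn _ _ _

theorem covMat_kalmanError (hp : p.Valid) (hn : p.IsNoise Pr x0 w v)
    (hP : Tendsto p.kalmanCov atTop (𝓝 P)) (hSig : p.Sig = P) (hinv : IsUnit (p.innovCov P))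
    (hK : K = p.gain P) (k : ℕ) : covMat Pr (kalmanError p K x0 w v k) = P := by
  induction k with
  | zero =>
    rw [kalmanError_zero, covMat_mulVec (isL2_of_hasLaw hn.law_x0),
      covMat_of_hasLaw hp.Sig_psd hn.law_x0, hSig]
    simp
  | succ k ih =>
    have h := isPast_kalmanError (K := K) hn k
    rw [kalmanError_succ, ← crossCov_self, crossCov_step hp hn h h, crossCov_self, ih,
      p.joseph_form hP hinv hK]

variable {ι ι' : Type*}

/-- `X` is determined by the past and uncorrelated with the error of the Kalman estimate. -/
structure IsObserved (p : Plant nu ns m) (K : Matrix (Ix nu ns) (Fin m) ℝ) (Pr : Measure Ω)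
    (x0 : Ω → Ix nu ns → ℝ) (w : ℕ → Ω → Ix nu ns → ℝ) (v : ℕ → Ω → Fin m → ℝ) (k : ℕ)
    (X : Ω → ι → ℝ) : Prop where
  isPast : IsPast Pr w v k X
  cov_error : crossCov Pr (kalmanError p K x0 w v k) X = 0

namespace IsObserved

theorem zero (hn : p.IsNoise Pr x0 w v) (k : ℕ) :
    IsObserved p K Pr x0 w v k (fun _ => (0 : ι → ℝ)) := by
  have h0 : IsPast Pr w v k fun _ : Ω => (0 : ι → ℝ) := by
    simpa using (hn.isPast_x0.mono k.zero_le).mulVec hn (0 : Matrix ι _ ℝ)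
  refine ⟨h0, ?_⟩
  ext s i
  exact covariance_zero_right

theorem add (hn : p.IsNoise Pr x0 w v) {k : ℕ} {X Y : Ω → ι → ℝ}
    (hX : IsObserved p K Pr x0 w v k X) (hY : IsObserved p K Pr x0 w v k Y) :
    IsObserved p K Pr x0 w v k fun ω => X ω + Y ω :=
  ⟨hX.isPast.add hn hY.isPast, by
    rw [crossCov_add_right (isPast_kalmanError hn k).isL2 hX.isPast.isL2 hY.isPast.isL2,
      hX.cov_error, hY.cov_error, add_zero]⟩

theorem mulVec [Fintype ι] (hn : p.IsNoise Pr x0 w v) {k : ℕ} {X : Ω → ι → ℝ}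
    (hX : IsObserved p K Pr x0 w v k X) (M : Matrix ι' ι ℝ) :
    IsObserved p K Pr x0 w v k fun ω => M *ᵥ X ω :=
  ⟨hX.isPast.mulVec hn M, by
    rw [crossCov_mulVec_right (isPast_kalmanError hn k).isL2 hX.isPast.isL2, hX.cov_error,
      Matrix.zero_mul]⟩

theorem succ [Fintype ι] [DecidableEq ι] (hp : p.Valid) (hn : p.IsNoise Pr x0 w v) {k : ℕ}
    {X : Ω → ι → ℝ} (hX : IsObserved p K Pr x0 w v k X) :
    IsObserved p K Pr x0 w v (k + 1) X := by
  refine ⟨hX.isPast.mono k.le_succ, ?_⟩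
  -- `X` is viewed as a system with identity dynamics and no noise input, so the old zero
  -- correlation is merely multiplied by `A - KCA`.
  have h := crossCov_step hp hn (isPast_kalmanError (K := K) hn k) hX.isPast
    (p.A - K * p.C * p.A) (K * p.C - 1) K (1 : Matrix ι ι ℝ) 0 0
  simp only [zero_mulVec, one_mulVec, add_zero, hX.cov_error, transpose_zero, Matrix.mul_zero,
    Matrix.zero_mul] at h
  rw [kalmanError_succ]
  exact h

theorem innovation (hp : p.Valid) (hn : p.IsNoise Pr x0 w v)
    (hP : Tendsto p.kalmanCov atTop (𝓝 P)) (hSig : p.Sig = P) (hinv : IsUnit (p.innovCov P))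
    (hK : K = p.gain P) (k : ℕ) :
    IsObserved p K Pr x0 w v (k + 1) fun ω => (-(p.C * p.A)) *ᵥ kalmanError p K x0 w v k ω
      + p.C *ᵥ w k ω + (1 : Matrix (Fin m) (Fin m) ℝ) *ᵥ v (k + 1) ω := by
  have h := isPast_kalmanError (K := K) hn k
  refine ⟨h.step hn _ _ _, ?_⟩
  rw [kalmanError_succ, crossCov_step hp hn h h, crossCov_self,
    covMat_kalmanError hp hn hP hSig hinv hK, p.gain_orthogonality hinv hK]

/-- The local filter states and the consensus states are uncorrelated with the error of the Kalman
estimate. -/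
theorem filters (hp : p.Valid) (hn : p.IsNoise Pr x0 w v)
    (hP : Tendsto p.kalmanCov atTop (𝓝 P)) (hSig : p.Sig = P) (hinv : IsUnit (p.innovCov P))
    (hK : K = p.gain P) {f : LocalFilter nu ns m} (hf : f.IsDecomposition p K)
    (a : Matrix (Fin m) (Fin m) ℝ) (Γ : Ix nu ns → ℝ) (k : ℕ) :
    IsObserved p K Pr x0 w v k (fun ω => xiVec f (path p x0 w v ω) k) ∧
      IsObserved p K Pr x0 w v k (fun ω => etaVec a f Γ (path p x0 w v ω) k) := by
  induction k with
  | zero => exact ⟨zero hn 0, zero hn 0⟩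
  | succ k ih =>
    obtain ⟨hxi, heta⟩ := ih
    replace hxi := hxi.succ hp hn
    replace heta := heta.succ hp hn
    -- By `x̂ = F ξ`, the new measurement is a linear function of `ξ(k)` plus the innovation, both
    -- uncorrelated with the new error.
    have hy : IsObserved p K Pr x0 w v (k + 1) fun ω => path p x0 w v ω (k + 1) := by
      have h := ((hxi.mulVec hn f.bigF).mulVec hn (p.C * p.A)).add hn
        (innovation hp hn hP hSig hinv hK k)
      have he : (fun ω => path p x0 w v ω (k + 1)) = fun ω =>
          (p.C * p.A) *ᵥ (f.bigF *ᵥ xiVec f (path p x0 w v ω) k)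
          + ((-(p.C * p.A)) *ᵥ kalmanError p K x0 w v k ω
          + p.C *ᵥ w k ω + (1 : Matrix (Fin m) (Fin m) ℝ) *ᵥ v (k + 1) ω) := by
        funext ω
        rw [← estimate_eq_bigF_mulVec _ hf]
        exact p.meas_succ _ _ _ k
      rwa [he]
    simp only [xiVec_succ, etaVec_succ, resid_eq, mulVec_sub]
    refine ⟨(hxi.mulVec hn _).add hn (hy.mulVec hn _), (heta.mulVec hn _).add hn ?_⟩
    have h := (hy.mulVec hn (Leta nu ns m)).add hn
      ((hxi.mulVec hn (Gtil m f.β)).mulVec hn (-Leta nu ns m))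
    simpa only [neg_mulVec, ← sub_eq_add_neg] using h

end IsObserved

end Kalman

/-! ### The asymptotic covariances -/

section Asymptotic

variable {nu ns m : ℕ} {p : Plant nu ns m} {f : LocalFilter nu ns m}
  {K : Matrix (Ix nu ns) (Fin m) ℝ}

/-- `Λ` is Schur and `Aᵘ` has no eigenvalue inside the circle, so they share none; `χ_S` kills `Aᵘ`
because `χ_{Aᵘ}` divides it. -/
theorem existsUnique_G (hp : p.Valid) (hf : f.IsDecomposition p K) :
    ∃ G : Fin m → Matrix (Ix nu ns) (Fin nu) ℝ,
      ∀ i G', (f.S * G' = G' * p.Au ∧ f.β ᵥ* G' = p.C.toCols₁ i ᵥ* p.Au) ↔ G' = G i := by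
  have hSL : IsCoprime f.S.charpoly f.Lam.charpoly := isCoprime_charpoly hf.S_disjoint
  have hLA : IsCoprime f.Lam.charpoly p.Au.charpoly :=
    isCoprime_charpoly (Set.disjoint_left.2 fun z h1 h2 =>
      absurd (hf.lam_schur z h1) (not_lt.2 (hp.unstable z h2)))
  have hAS : Polynomial.aeval p.Au f.S.charpoly = 0 := by
    obtain ⟨q, hq, -⟩ := hf.S_charpoly
    rw [hq, map_mul, Matrix.aeval_self_charpoly, zero_mul]
  choose G hG using fun i => existsUnique_intertwiner (b := 1) (c := f.β) rfl hSL hLA hAS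
    (p.C.toCols₁ i ᵥ* p.Au)
  exact ⟨G, hG⟩

/-- `1_m ⊗ I_n`. -/
def onesCol (nu ns m : ℕ) : Matrix (Fin m × Ix nu ns) (Ix nu ns) ℝ :=
  Matrix.of fun is s => if is.2 = s then 1 else 0

theorem onesCol_mulVec_apply (x : Ix nu ns → ℝ) (is : Fin m × Ix nu ns) :
    (onesCol nu ns m *ᵥ x) is = x is.2 := by
  simp [onesCol, Matrix.mulVec, dotProduct]

theorem onesCol_mul_mul_transpose (P : Matrix (Ix nu ns) (Ix nu ns) ℝ) :
    onesCol nu ns m * P * (onesCol nu ns m)ᵀ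
      = (Matrix.of fun _ _ => 1 : Matrix (Fin m) (Fin m) ℝ) ⊗ₖ P := by
  ext ⟨i, s⟩ ⟨j, t⟩
  simp [onesCol, Matrix.mul_apply]

variable {Ω : Type*} [MeasurableSpace Ω] {Pr : Measure Ω} [IsProbabilityMeasure Pr]
  {x0 : Ω → Ix nu ns → ℝ} {w : ℕ → Ω → Ix nu ns → ℝ} {v : ℕ → Ω → Fin m → ℝ}
  {a : Matrix (Fin m) (Fin m) ℝ} {μ : Fin m → ℝ} {Φ : Matrix (Fin m) (Fin m) ℝ}
  {Γ : Ix nu ns → ℝ} {G : Fin m → Matrix (Ix nu ns) (Fin nu) ℝ}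

/-- The stacked gap between the fused estimates and the Kalman estimate. -/
noncomputable def fusionGap (p : Plant nu ns m) (f : LocalFilter nu ns m)
    (K : Matrix (Ix nu ns) (Fin m) ℝ) (a : Matrix (Fin m) (Fin m) ℝ) (Γ : Ix nu ns → ℝ)
    (y : ℕ → Fin m → ℝ) (k : ℕ) : Fin m × Ix nu ns → ℝ :=
  fun is => fused a f Γ y k is.1 is.2 - p.estimate K y k is.2

/-- Written through `η` and `ξ`, the gap inherits their lack of correlation with the Kalman error.
-/
theorem fusionGap_eq (hf : f.IsDecomposition p K) (y : ℕ → Fin m → ℝ) (k : ℕ) :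
    fusionGap p f K a Γ y k = ((1 : Matrix (Fin m) (Fin m) ℝ) ⊗ₖ ((m : ℝ) • f.bigF)) *ᵥ
      etaVec a f Γ y k + (-(onesCol nu ns m * f.bigF)) *ᵥ xiVec f y k := by
  ext ⟨i, s⟩
  rw [fusionGap, estimate_eq_bigF_mulVec _ hf, Pi.add_apply, one_kronecker_mulVec_apply, neg_mulVec,
    Pi.neg_apply, ← mulVec_mulVec, onesCol_mulVec_apply, smul_mulVec]
  rfl

theorem isPast_redState (hn : p.IsNoise Pr x0 w v) (hΦ : IsLapDiag a μ Φ)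
    (hG : ∀ i, f.S * G i = G i * p.Au ∧ f.β ᵥ* G i = p.C.toCols₁ i ᵥ* p.Au) (k : ℕ) :
    IsPast Pr w v k fun ω =>
      redState p f a Γ Φ G (x0 ω) (fun t => w t ω) (fun t => v t ω) k := by
  induction k with
  | zero =>
    simp only [redState_zero]
    exact hn.isPast_x0.mulVec hn _
  | succ k ih =>
    simp only [redState_succ hΦ Γ hG]
    exact ih.step hn _ _ _

theorem covMat_redState_succ (hp : p.Valid) (hn : p.IsNoise Pr x0 w v) (hΦ : IsLapDiag a μ Φ)
    (hG : ∀ i, f.S * G i = G i * p.Au ∧ f.β ᵥ* G i = p.C.toCols₁ i ᵥ* p.Au) (k : ℕ) :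
    covMat Pr (fun ω => redState p f a Γ Φ G (x0 ω) (fun t => w t ω) (fun t => v t ω) (k + 1))
      = lyapRHS p f Γ μ Φ G (covMat Pr fun ω =>
          redState p f a Γ Φ G (x0 ω) (fun t => w t ω) (fun t => v t ω) k) := by
  have h := isPast_redState (Γ := Γ) hn hΦ hG k
  simp only [redState_succ hΦ Γ hG]
  exact crossCov_step hp hn h h _ _ _ _ _ _

theorem tendsto_covMat_fusionGap (hm : m ≠ 0) (hp : p.Valid) (hn : p.IsNoise Pr x0 w v)
    (hf : f.IsDecomposition p K) (ha : IsNetwork a) (hΦ : IsLapDiag a μ Φ)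
    (hG : ∀ i, f.S * G i = G i * p.Au ∧ f.β ᵥ* G i = p.C.toCols₁ i ᵥ* p.Au)
    (hAr : IsSchur (Ar p f Γ μ Φ)) {Wr : Matrix (RIx nu ns m) (RIx nu ns m) ℝ}
    (hWr : Wr = lyapRHS p f Γ μ Φ G Wr) :
    Tendsto (fun k => covMat Pr fun ω => fusionGap p f K a Γ (path p x0 w v ω) k) atTop
      (𝓝 (outMat f Φ * Wr * (outMat f Φ)ᵀ)) := by
  have hlim : Tendsto (fun k => covMat Pr fun ω =>
      redState p f a Γ Φ G (x0 ω) (fun t => w t ω) (fun t => v t ω) k) atTop (𝓝 Wr) := by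
    refine tendsto_lyapunov_iterate hAr (hWr.trans (add_assoc _ _ _)) fun k => ?_
    rw [covMat_redState_succ hp hn hΦ hG, lyapRHS, add_assoc]
  have hgap : ∀ k, (covMat Pr fun ω => fusionGap p f K a Γ (path p x0 w v ω) k)
      = outMat f Φ * (covMat Pr fun ω =>
          redState p f a Γ Φ G (x0 ω) (fun t => w t ω) (fun t => v t ω) k) * (outMat f Φ)ᵀ :=
    fun k => by
      rw [← covMat_mulVec (isPast_redState hn hΦ hG k).isL2]
      congr 1
      funext ω
      exact fused_sub_estimate_eq hm ha hΦ hf Γ G _ _ _ k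
  simp only [hgap]
  have hc : Continuous fun X : Matrix (RIx nu ns m) (RIx nu ns m) ℝ =>
      outMat f Φ * X * (outMat f Φ)ᵀ := by fun_prop
  exact (hc.tendsto Wr).comp hlim

/-- Both cross terms vanish by orthogonality, and all sensors carry the same Kalman error, whence
the all-ones block pattern. The identity is exact at every `k`, not only in the limit. -/
theorem covMat_fusionGap_add_error {P : Matrix (Ix nu ns) (Ix nu ns) ℝ} (hp : p.Valid)
    (hn : p.IsNoise Pr x0 w v) (hP : Tendsto p.kalmanCov atTop (𝓝 P)) (hSig : p.Sig = P)
    (hinv : IsUnit (p.innovCov P)) (hK : K = p.gain P) (hf : f.IsDecomposition p K) (k : ℕ) :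
    covMat Pr (fun ω => fusionGap p f K a Γ (path p x0 w v ω) k
        + onesCol nu ns m *ᵥ kalmanError p K x0 w v k ω)
      = (covMat Pr fun ω => fusionGap p f K a Γ (path p x0 w v ω) k)
        + (Matrix.of fun _ _ => 1 : Matrix (Fin m) (Fin m) ℝ) ⊗ₖ P := by
  have hgap : IsObserved p K Pr x0 w v k fun ω => fusionGap p f K a Γ (path p x0 w v ω) k := by
    obtain ⟨hxi, heta⟩ := IsObserved.filters hp hn hP hSig hinv hK hf a Γ k
    simp only [fusionGap_eq hf]
    exact (heta.mulVec hn _).add hn (hxi.mulVec hn _)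
  have he := (isPast_kalmanError (K := K) hn k).isL2
  have hTe := he.mulVec (onesCol nu ns m)
  have hg := hgap.isPast.isL2
  have h1 : crossCov Pr (fun ω => onesCol nu ns m *ᵥ kalmanError p K x0 w v k ω)
      (fun ω => fusionGap p f K a Γ (path p x0 w v ω) k) = 0 := by
    rw [crossCov_mulVec_left he hg, hgap.cov_error, Matrix.mul_zero]
  have h2 : crossCov Pr (fun ω => fusionGap p f K a Γ (path p x0 w v ω) k)
      (fun ω => onesCol nu ns m *ᵥ kalmanError p K x0 w v k ω) = 0 := by
    rw [← crossCov_transpose, h1, transpose_zero]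
  rw [← crossCov_self, crossCov_add_left hg hTe (hg.add hTe), crossCov_add_right hg hg hTe,
    crossCov_add_right hTe hg hTe, h1, h2, add_zero, zero_add, crossCov_self, crossCov_self,
    covMat_mulVec he, covMat_kalmanError hp hn hP hSig hinv hK, onesCol_mul_mul_transpose]

end Asymptotic

end DistKalman

open DistKalman in
theorem mainTheorem5 {nu ns m : ℕ} (hm : 2 ≤ m)
    (p : DistKalman.Plant nu ns m) (hp : p.Valid)
    -- steady-state Kalman filter: `P = lim P(k)`, started from `Sig = P`, with gain `K`
    (P : Matrix (DistKalman.Ix nu ns) (DistKalman.Ix nu ns) ℝ)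
    (hP : Tendsto p.kalmanCov atTop (𝓝 P)) (hSig : p.Sig = P)
    (hinv : IsUnit (p.innovCov P))
    (K : Matrix (DistKalman.Ix nu ns) (Fin m) ℝ) (hK : K = p.gain P)
    -- initial state and noises
    {Ω : Type*} [MeasurableSpace Ω] (Pr : Measure Ω) [IsProbabilityMeasure Pr]
    (x0 : Ω → DistKalman.Ix nu ns → ℝ) (w : ℕ → Ω → DistKalman.Ix nu ns → ℝ)
    (v : ℕ → Ω → Fin m → ℝ) (hnoise : p.IsNoise Pr x0 w v)
    -- local filters
    (f : DistKalman.LocalFilter nu ns m) (hf : f.IsDecomposition p K)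
    -- network, Laplacian eigenvalues `μ₂ ≤ μm`, diagonalizing matrix
    (a : Matrix (Fin m) (Fin m) ℝ) (ha : DistKalman.IsNetwork a)
    (μ : Fin m → ℝ) (Φ : Matrix (Fin m) (Fin m) ℝ) (hΦ : DistKalman.IsLapDiag a μ Φ)
    (μ₂ μm : ℝ) (hμ₂ : μ₂ = μ ⟨1, by omega⟩) (hμm : μm = μ ⟨m - 1, by omega⟩)
    -- Mahler measure condition, cleared of the denominator `1 - μ₂/μm` (which may vanish)
    (hmahler : DistKalman.unstableProd f.S * (1 - μ₂ / μm) < 1 + μ₂ / μm)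
    -- design of the consensus gain
    (ζ : ℝ) (hζ : 0 < ζ) (hζ₁ : DistKalman.unstableProd f.S < ζ⁻¹)
    (hζ₂ : ζ⁻¹ * (1 - μ₂ / μm) ≤ 1 + μ₂ / μm)
    (M : Matrix (DistKalman.Ix nu ns) (DistKalman.Ix nu ns) ℝ) (hM : M.PosDef)
    (hric : DistKalman.RiccatiIneq ζ M f.S)
    (Γ : DistKalman.Ix nu ns → ℝ) (hΓ : Γ = DistKalman.consensusGain μ₂ μm M f.S)
    -- the processes: state, measurements, Kalman estimate, local estimates
    (x : ℕ → Ω → DistKalman.Ix nu ns → ℝ)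
    (hx : x = fun k ω => p.state (x0 ω) (fun t => w t ω) k)
    (y : Ω → ℕ → Fin m → ℝ)
    (hy : y = fun ω k => p.meas (x0 ω) (fun t => w t ω) (fun t => v t ω) k)
    (xhat : ℕ → Ω → DistKalman.Ix nu ns → ℝ) (hxhat : xhat = fun k ω => p.estimate K (y ω) k)
    (xloc : ℕ → Fin m → Ω → DistKalman.Ix nu ns → ℝ)
    (hxloc : xloc = fun k i ω => DistKalman.fused a f Γ (y ω) k i) :
    ∃ (G : Fin m → Matrix (DistKalman.Ix nu ns) (Fin nu) ℝ)
      (Wr : Matrix (DistKalman.RIx nu ns m) (DistKalman.RIx nu ns m) ℝ)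
      (Wbar : Matrix (Fin m × DistKalman.Ix nu ns) (Fin m × DistKalman.Ix nu ns) ℝ),
      -- `G i` is the unique solution of `S G = G Aᵘ`, `βᵀ G = Cᵘ_i Aᵘ`
      (∀ i G', (f.S * G' = G' * p.Au ∧ f.β ᵥ* G' = p.C.toCols₁ i ᵥ* p.Au) ↔ G' = G i) ∧
      -- `Wr` is the unique solution of the Lyapunov equation
      (∀ X, X = DistKalman.lyapRHS p f Γ μ Φ G X ↔ X = Wr) ∧
      Wbar = DistKalman.outMat f Φ * Wr * (DistKalman.outMat f Φ)ᵀ ∧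
      -- `Wbar` is the asymptotic covariance of the gap to the Kalman estimate
      Tendsto (fun k => DistKalman.covMat Pr
        (fun ω (is : Fin m × DistKalman.Ix nu ns) => xloc k is.1 ω is.2 - xhat k ω is.2))
        atTop (𝓝 Wbar) ∧
      -- `P` is the error covariance of the Kalman estimate
      (∀ k, DistKalman.covMat Pr (fun ω s => xhat k ω s - x k ω s) = P) ∧
      -- the asymptotic error covariance of the stacked local estimates
      Tendsto (fun k => DistKalman.covMat Pr
        (fun ω (is : Fin m × DistKalman.Ix nu ns) => xloc k is.1 ω is.2 - x k ω is.2))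
        atTop (𝓝 (Wbar + (Matrix.of fun _ _ => 1 : Matrix (Fin m) (Fin m) ℝ) ⊗ₖ P)) := by
  subst hμ₂ hμm hΓ hx hy hxhat hxloc
  obtain ⟨G, hG⟩ := existsUnique_G hp hf
  have hG' : ∀ i, f.S * G i = G i * p.Au ∧ f.β ᵥ* G i = p.C.toCols₁ i ᵥ* p.Au :=
    fun i => (hG i (G i)).2 rfl
  -- Indices start at `0`, so `μ₂` and `μm` sit at `1` and `m - 1`; monotonicity places the other
  -- nontrivial eigenvalues between them.
  have hAr := isSchur_Ar (Φ := Φ) hp hf.lam_schur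
    (hΦ.eigenvalue_pos ha ⟨⟨1, by omega⟩, one_ne_zero⟩)
    (fun j => hΦ.mono (Fin.le_def.2 (Nat.one_le_iff_ne_zero.2 j.2)))
    (fun j => hΦ.mono (Fin.le_def.2 (Nat.le_sub_one_of_lt j.1.2))) hζ hζ₂ hM hric
  obtain ⟨Wr, hWr⟩ := existsUnique_lyapunov hAr
    (Bw p Φ G * p.Q * (Bw p Φ G)ᵀ + Bv nu ns Φ * p.R * (Bv nu ns Φ)ᵀ)
  simp only [← add_assoc] at hWr
  have hlim := tendsto_covMat_fusionGap (Pr := Pr) (by omega) hp hnoise hf ha hΦ hG' hAr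
    ((hWr Wr).2 rfl)
  refine ⟨G, Wr, _, hG, hWr, rfl, hlim,
    covMat_kalmanError hp hnoise hP hSig hinv hK, ?_⟩
  refine (hlim.add_const _).congr fun k => ?_
  rw [← covMat_fusionGap_add_error hp hnoise hP hSig hinv hK hf]
  congr 1
  funext ω is
  rw [Pi.add_apply, onesCol_mulVec_apply]
  exact sub_add_sub_cancel _ _ _
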